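/- **Setting.** Let $V=\mathbb C^7$ with basis $(e_1,e_2,e_3,R,f_3,f_2,f_1)$ and the symmetric bilinear form $g$ whose matrix in this basis is $g_{ij}=\delta_{i,8-j}$. Put $E=\langle e_1,e_2,e_3\rangle$, $F=\langle f_3,f_2,f_1\rangle$, and let $e^1,e^2,e^3$ be the basis of $E^*$ dual to $e_1,e_2,e_3$. The $8$-dimensional space $S=\Lambda^\bullet E^*$ is a module over the Clifford algebra of $V$ with relations $v\cdot w+w\cdot v=-2g(v,w)$, through $$e\cdot\phi=-\sqrt2\,\iota_e\phi,\qquad f\cdot\phi=\sqrt2\,f^\flat\wedge\phi,\qquad R\cdot\phi=\pm i\,\phi\ \ (+\text{ for }\phi\text{ even},\ -\text{ for }\phi\text{ odd}),$$ for $e\in E$, $f\in F$, where $f^\flat=g(f,\cdot)|_E$. Let $\mathrm{Spin}(7)$ be the complex spin group in this Clifford algebra, that is, the group of products $v_1\cdots v_{2k}$ of an even number of vectors of $V$ with $g(v_j,v_j)=1$. It acts on $S$ by restriction of the Clifford action. Let $$(\phi_0,\phi_1,\phi_2,\phi_3,\psi_0,\psi_1,\psi_2,\psi_3)=(1,\;e^1,\;e^2,\;e^3,\;-e^1\wedge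 e^2\wedge e^3,\;e^2\wedge e^3,\;e^3\wedge e^1,\;e^1\wedge e^2),$$ a basis of $S$ with dual basis $(\phi^0,\dots,\phi^3,\psi^0,\dots,\psi^3)$, and let $$\eta=\phi^0\psi^0+\phi^1\psi^1+\phi^2\psi^2+\phi^3\psi^3,$$ the symmetric bilinear form whose only non-zero values on basis vectors are $\eta(\phi_i,\psi_i)=\eta(\psi_i,\phi_i)=1$. The Cayley $4$-form $Q\in\Lambda^4S^*$ is $$\begin{aligned}Q={}&\phi^0\wedge\phi^1\wedge\psi^0\wedge\psi^1+\phi^0\wedge\phi^2\wedge\psi^0\wedge\psi^2+\phi^0\wedge\phi^3\wedge\psi^0\wedge\psi^3\\&-\phi^1\wedge\phi^2\wedge\psi^1\wedge\psi^2-\phi^1\wedge\phi^3\wedge\psi^1\wedge\psi^3-\phi^2\wedge\phi^3\wedge\psi^2\wedge\psi^3\\&-2\,\phi^0\wedge\psi^1\wedge\psi^2\wedge\psi^3+2\,\phi^1\wedge\phi^2\wedge\phi^3\wedge\psi^0.\end{aligned}$$ The Hodge star on $\Lambda^4S^*$ is defined by $\alpha\wedge\star\beta=\eta(\alpha,\beta)\,\mathrm{vol}$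 for all $\alpha,\beta\in\Lambda^4S^*$, where $\mathrm{vol}=\phi^0\wedge\dots\wedge\phi^3\wedge\psi^0\wedge\dots\wedge\psi^3$ and $\eta(\cdot,\cdot)$ is the bilinear form induced by $\eta$ on $\Lambda^4S^*$ through determinants. Let $\mathrm{CO}(S)\subset\mathrm{GL}(S)$ be the subgroup preserving the conformal class $[\eta]=\{\lambda\eta:\lambda\in\mathbb C^\times\}$, let $\mathrm O(S)$ be the isometry group of $\eta$, and put $[Q]=\{\lambda Q:\lambda\in\mathbb C^\times\}$. **Lemma 6.1.** The Cayley $4$-form is anti-self-dual: $\star Q=-Q$. Moreover $\mathrm{CO}(S)=\mathbb C^\times\cdot\mathrm O(S)$, the group $\mathrm{Spin}(7)$ acts faithfully on $S$, so that it may be regarded as a subgroup of $\mathrm{GL}(S)$, and the stabilizer of the conformal class $[Q]$ in $\mathrm{CO}(S)$ is $$\mathrm{Stab}_{\mathrm{CO}(S)}([Q])=\mathrm{CSpin}(7)=\mathbb C^\times\cdot\mathrm{Spin}(7)\subset\mathrm{GL}(S).$$ -/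

import Mathlib

open scoped BigOperators

noncomputable section

namespace CayleySpin

/-! ### The spin representation of `Spin(7)` on `S = Λ E^*` -/

/-- `E = ℂ³`, with basis `e₁, e₂, e₃`. -/
abbrev E : Type := Fin 3 → ℂ

/-- The coordinate functionals `e¹, e², e³` (indices shifted by one). -/
def dualE (i : Fin 3) : Module.Dual ℂ E := LinearMap.proj i

/-- The spinor module `S = Λ E^*`. -/
abbrev S : Type := ExteriorAlgebra ℂ (Module.Dual ℂ E)

/-- `V = ℂ⁷ = E ⊕ ℂR ⊕ F`, the coordinates being taken with respect to
`(e₁, e₂, e₃, R, f₃, f₂, f₁)`. -/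
abbrev V : Type := Fin 7 → ℂ

/-- The symmetric bilinear form `g` on `V` with matrix entries `g_{ij} = δ_{i, 8-j}`
(`1 ≤ i, j ≤ 7`). -/
def g : LinearMap.BilinForm ℂ V :=
  ∑ i : Fin 7, LinearMap.BilinForm.linMulLin (LinearMap.proj i) (LinearMap.proj i.rev)

/-- The quadratic form `v ↦ -g(v,v)`; the Clifford algebra has the relations
`v · w + w · v = -2 g(v,w)`. -/
def q : QuadraticForm ℂ V := (-g).toQuadraticMap

/-- The component in `E` of a vector of `V`. -/
def projE : V →ₗ[ℂ] E := LinearMap.pi ![LinearMap.proj 0, LinearMap.proj 1, LinearMap.proj 2]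

/-- For `v ∈ V` with component `f` in `F`, the form `f^♭ = g(f, ·)|_E ∈ E^*`; thus
`f_i^♭ = e^i`. -/
def flatF : V →ₗ[ℂ] Module.Dual ℂ E where
  toFun v := v 6 • dualE 0 + v 5 • dualE 1 + v 4 • dualE 2
  map_add' v w := by simp only [Pi.add_apply]; module
  map_smul' c v := by simp only [Pi.smul_apply, smul_eq_mul, RingHom.id_apply]; module

/-- The interior product `ι_e` on `Λ E^*`. -/
def interior (e : E) : Module.End ℂ S :=
  CliffordAlgebra.contractLeft (Q := (0 : QuadraticForm ℂ (Module.Dual ℂ E)))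
    (Module.Dual.eval ℂ E e)

/-- The exterior product `α ∧ ·` on `Λ E^*`. -/
def exterior (α : Module.Dual ℂ E) : Module.End ℂ S :=
  LinearMap.mulLeft ℂ (ExteriorAlgebra.ι ℂ α)

/-- The parity operator of `Λ E^*`: `+1` on even forms, `-1` on odd forms. -/
def parity : Module.End ℂ S :=
  (CliffordAlgebra.involute (Q := (0 : QuadraticForm ℂ (Module.Dual ℂ E)))).toLinearMap

lemma interior_add (e e' : E) : interior (e + e') = interior e + interior e' := by
  simp [interior]

lemma interior_smul (c : ℂ) (e : E) : interior (c • e) = c • interior e := by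
  simp [interior]

lemma exterior_add (a b : Module.Dual ℂ E) : exterior (a + b) = exterior a + exterior b := by
  apply LinearMap.ext
  intro x
  simp [exterior, add_mul]

lemma exterior_smul (c : ℂ) (a : Module.Dual ℂ E) : exterior (c • a) = c • exterior a := by
  apply LinearMap.ext
  intro x
  simp [exterior]

/-- The Clifford action of `V` on `S`:
`e · φ = -√2 ι_e φ`, `f · φ = √2 f^♭ ∧ φ`, and `R · φ = ± i φ` for `φ` even, resp. odd. -/
def cliffordAction : V →ₗ[ℂ] Module.End ℂ S where
  toFun v := (-(Real.sqrt 2 : ℂ)) • interior (projE v) + (Real.sqrt 2 : ℂ) • exterior (flatF v)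
    + (v 3 * Complex.I) • parity
  map_add' v w := by
    simp only [map_add, interior_add, exterior_add, Pi.add_apply]; module
  map_smul' c v := by
    simp only [map_smul, interior_smul, exterior_smul, Pi.smul_apply, smul_eq_mul,
      RingHom.id_apply]; module

lemma interior_sq (e : E) : interior e * interior e = 0 := by
  apply LinearMap.ext
  intro x
  exact CliffordAlgebra.contractLeft_contractLeft
    (Q := (0 : QuadraticForm ℂ (Module.Dual ℂ E))) (d := Module.Dual.eval ℂ E e) x

lemma exterior_sq (a : Module.Dual ℂ E) : exterior a * exterior a = 0 := by
  apply LinearMap.ext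
  intro x
  simp [exterior, ← mul_assoc]

lemma interior_exterior (e : E) (a : Module.Dual ℂ E) :
    interior e * exterior a = a e • 1 - exterior a * interior e := by
  apply LinearMap.ext
  intro x
  have := CliffordAlgebra.contractLeft_ι_mul (Q := (0 : QuadraticForm ℂ (Module.Dual ℂ E)))
    (Module.Dual.eval ℂ E e) a x
  simpa [interior, exterior] using this

lemma parity_sq : parity * parity = 1 := by
  apply LinearMap.ext
  intro x
  simp [parity]

lemma parity_exterior (a : Module.Dual ℂ E) : parity * exterior a = -(exterior a * parity) := by
  apply LinearMap.ext
  intro x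
  have : CliffordAlgebra.involute (Q := (0 : QuadraticForm ℂ (Module.Dual ℂ E)))
      (ExteriorAlgebra.ι ℂ a) = -ExteriorAlgebra.ι ℂ a := CliffordAlgebra.involute_ι a
  simp [parity, exterior, this]

lemma parity_interior (e : E) : parity * interior e = -(interior e * parity) := by
  apply LinearMap.ext
  intro x
  induction x using CliffordAlgebra.left_induction with
  | algebraMap r =>
    have h : interior e (algebraMap ℂ S r) = 0 :=
      CliffordAlgebra.contractLeft_algebraMap (Q := (0 : QuadraticForm ℂ (Module.Dual ℂ E)))
        (Module.Dual.eval ℂ E e) r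
    have h' : parity (algebraMap ℂ S r) = algebraMap ℂ S r := by simp [parity]
    simp [Module.End.mul_apply, h, h']
  | add x y hx hy => simp only [map_add, hx, hy]
  | ι_mul x m hx =>
    have e1 : CliffordAlgebra.ι 0 m * x = exterior m x := rfl
    have hp : parity (exterior m x) = -exterior m (parity x) := by
      simpa using LinearMap.congr_fun (parity_exterior m) x
    have hi : ∀ y, interior e (exterior m y) = m e • y - exterior m (interior e y) := fun y => by
      simpa using LinearMap.congr_fun (interior_exterior e m) y
    have hp' : ∀ y, parity (exterior m y) = -exterior m (parity y) := fun y => by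
      simpa using LinearMap.congr_fun (parity_exterior m) y
    have hx' : parity (interior e x) = -interior e (parity x) := by simpa using hx
    rw [e1]
    simp only [Module.End.mul_apply, LinearMap.neg_apply, hi, hp', map_sub, map_smul, map_neg, hx']
    module

lemma flatF_projE (v : V) :
    flatF v (projE v) = v 6 * v 0 + v 5 * v 1 + v 4 * v 2 := by
  simp [flatF, projE, dualE]

lemma q_apply (v : V) : q v = -(2 * (v 6 * v 0 + v 5 * v 1 + v 4 * v 2) + v 3 * v 3) := by
  have : ∀ i : Fin 7, i.rev = ![6, 5, 4, 3, 2, 1, 0] i := by decide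
  simp [q, g, this, Fin.sum_univ_succ, LinearMap.BilinMap.toQuadraticMap_apply,
    LinearMap.BilinForm.linMulLin_apply]
  ring

lemma cliffordAction_sq (v : V) :
    cliffordAction v * cliffordAction v = algebraMap ℂ _ (q v) := by
  have h2 : (Real.sqrt 2 : ℂ) * (Real.sqrt 2 : ℂ) = 2 := by
    rw [← Complex.ofReal_mul, Real.mul_self_sqrt (by norm_num)]; norm_num
  have h2' : (Real.sqrt 2 : ℂ) ^ 2 = 2 := by rw [sq, h2]
  have hI : (v 3 * Complex.I) * (v 3 * Complex.I) = -(v 3 * v 3) := by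
    linear_combination (v 3 * v 3) * Complex.I_mul_I
  simp only [cliffordAction, LinearMap.coe_mk, AddHom.coe_mk, add_mul, mul_add,
    smul_mul_assoc, mul_smul_comm, interior_sq, exterior_sq, parity_sq, parity_exterior,
    parity_interior, interior_exterior, flatF_projE, q_apply, smul_smul, smul_sub, smul_add,
    smul_neg, smul_zero, Algebra.algebraMap_eq_smul_one, hI, neg_mul, mul_neg, h2, neg_smul]
  match_scalars <;> ring_nf <;> simp only [h2'] <;> ring

/-- The Clifford module structure of `S`. -/
def cliffordRep : CliffordAlgebra q →ₐ[ℂ] Module.End ℂ S :=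
  CliffordAlgebra.lift q ⟨cliffordAction, cliffordAction_sq⟩

/-- `GL(S)`. -/
abbrev GLS : Type := LinearMap.GeneralLinearGroup ℂ S

/-- The spin representation `Spin(7) → GL(S)`, the restriction of the Clifford action to the
(complex) spin group. -/
def spinRep : spinGroup q →* GLS :=
  (Units.map cliffordRep.toRingHom.toMonoidHom).comp spinGroup.toUnits

/-- `Spin(7)` as a group of automorphisms of `S`. -/
def Spin7 : Subgroup GLS := spinRep.range

/-! ### The basis `(φ₀, …, φ₃, ψ₀, …, ψ₃)` of `S` -/

/-- `e^i` as an element of `S`. -/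
def ε (i : Fin 3) : S := ExteriorAlgebra.ι ℂ (dualE i)

/-- `φ₀ = 1`, `φ_i = e^i`, and `ψ₀ = -e¹∧e²∧e³`, `ψ₁ = e²∧e³`, `ψ₂ = e³∧e¹`, `ψ₃ = e¹∧e²`. -/
def spinVec : Fin 4 ⊕ Fin 4 → S :=
  Sum.elim ![1, ε 0, ε 1, ε 2] ![-(ε 0 * ε 1 * ε 2), ε 1 * ε 2, ε 2 * ε 0, ε 0 * ε 1]

lemma finrank_S : Module.finrank ℂ S = 8 := by
  rw [Module.finrank_eq_card_basis ((Pi.basisFun ℂ (Fin 3)).dualBasis.ExteriorAlgebra)]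
  simp

instance : Module.Finite ℂ S :=
  Module.Finite.of_basis ((Pi.basisFun ℂ (Fin 3)).dualBasis.ExteriorAlgebra)

lemma ε_sq (i : Fin 3) : ε i * ε i = 0 := ExteriorAlgebra.ι_sq_zero _

lemma ε_swap (i j : Fin 3) : ε i * ε j = -(ε j * ε i) :=
  eq_neg_of_add_eq_zero_left (ExteriorAlgebra.ι_add_mul_swap _ _)

lemma ε_mul_spinVec (i : Fin 3) (k : Fin 4 ⊕ Fin 4) :
    ε i * spinVec k ∈ Submodule.span ℂ (Set.range spinVec) := by
  have hm : ∀ k, spinVec k ∈ Submodule.span ℂ (Set.range spinVec) :=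
    fun k => Submodule.subset_span ⟨k, rfl⟩
  have sq : ∀ (i : Fin 3) (x : S), ε i * (ε i * x) = 0 := fun i x => by
    rw [← mul_assoc, ε_sq, zero_mul]
  have s10 : ε 1 * ε 0 = -(ε 0 * ε 1) := ε_swap _ _
  have s20 : ε 2 * ε 0 = -(ε 0 * ε 2) := ε_swap _ _
  have s21 : ε 2 * ε 1 = -(ε 1 * ε 2) := ε_swap _ _
  have t10 : ∀ x, ε 1 * (ε 0 * x) = -(ε 0 * (ε 1 * x)) := fun x => by
    rw [← mul_assoc, s10, neg_mul, mul_assoc]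
  have t20 : ∀ x, ε 2 * (ε 0 * x) = -(ε 0 * (ε 2 * x)) := fun x => by
    rw [← mul_assoc, s20, neg_mul, mul_assoc]
  have t21 : ∀ x, ε 2 * (ε 1 * x) = -(ε 1 * (ε 2 * x)) := fun x => by
    rw [← mul_assoc, s21, neg_mul, mul_assoc]
  have h : ∃ (c : ℂ) (l : Fin 4 ⊕ Fin 4), ε i * spinVec k = c • spinVec l := by
    have v : ∀ x y : S, ∀ l, (x = y) → y = spinVec l →
        ∃ (c : ℂ) (l : Fin 4 ⊕ Fin 4), x = c • spinVec l :=
      fun x y l h h' => ⟨1, l, by rw [h, h', one_smul]⟩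
    have v' : ∀ x y : S, ∀ l, (x = -y) → y = spinVec l →
        ∃ (c : ℂ) (l : Fin 4 ⊕ Fin 4), x = c • spinVec l :=
      fun x y l h h' => ⟨-1, l, by rw [h, h', neg_one_smul]⟩
    have v0 : ∀ x : S, x = 0 → ∃ (c : ℂ) (l : Fin 4 ⊕ Fin 4), x = c • spinVec l :=
      fun x h => ⟨0, .inl 0, by rw [h, zero_smul]⟩
    rcases k with k | k <;> fin_cases i <;> fin_cases k <;>
      first
      | (apply v0; simp [spinVec, sq, ε_sq, s10, s20, s21, t10, t20, t21, mul_assoc]; done)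
      | (apply v _ _ (.inl 1) _ rfl; simp [spinVec]; done)
      | (apply v _ _ (.inl 2) _ rfl; simp [spinVec]; done)
      | (apply v _ _ (.inl 3) _ rfl; simp [spinVec]; done)
      | (apply v _ _ (.inr 1) _ rfl; simp [spinVec, s10, s20, s21]; done)
      | (apply v _ _ (.inr 2) _ rfl; simp [spinVec, s10, s20, s21]; done)
      | (apply v _ _ (.inr 3) _ rfl; simp [spinVec, s10, s20, s21]; done)
      | (apply v' _ _ (.inr 1) _ rfl; simp [spinVec, s10, s20, s21]; done)
      | (apply v' _ _ (.inr 2) _ rfl; simp [spinVec, s10, s20, s21]; done)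
      | (apply v' _ _ (.inr 3) _ rfl; simp [spinVec, s10, s20, s21]; done)
      | (apply v' _ _ (.inr 0) _ rfl
         simp [spinVec, s10, s20, s21, t10, t20, t21, mul_assoc]; done)
  obtain ⟨c, l, h⟩ := h
  rw [h]
  exact Submodule.smul_mem _ _ (hm l)

lemma spinVec_span : ⊤ ≤ Submodule.span ℂ (Set.range spinVec) := by
  intro x _
  induction x using CliffordAlgebra.left_induction with
  | algebraMap r =>
    rw [Algebra.algebraMap_eq_smul_one]
    exact Submodule.smul_mem _ _ (Submodule.subset_span ⟨.inl 0, rfl⟩)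
  | add x y hx hy => exact Submodule.add_mem _ (hx trivial) (hy trivial)
  | ι_mul x m hx =>
    have hm : m = ∑ i, m (Pi.single i 1) • dualE i := by
      ext j
      fin_cases j <;> simp [Fin.sum_univ_succ, dualE]
    have : CliffordAlgebra.ι 0 m * x = ∑ i, m (Pi.single i 1) • (ε i * x) := by
      have h1 : CliffordAlgebra.ι 0 m = ∑ i, m (Pi.single i 1) • ε i := by
        conv_lhs => rw [hm]
        rw [map_sum]
        simp only [map_smul]
        rfl
      rw [h1, Finset.sum_mul]
      simp only [smul_mul_assoc]
    rw [this]
    refine Submodule.sum_mem _ fun i _ => Submodule.smul_mem _ _ ?_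
    have key : Submodule.span ℂ (Set.range spinVec) ≤
        (Submodule.span ℂ (Set.range spinVec)).comap (LinearMap.mulLeft ℂ (ε i)) := by
      rw [Submodule.span_le]
      rintro _ ⟨k, rfl⟩
      exact ε_mul_spinVec i k
    exact key (hx trivial)

/-- The basis `(φ₀, …, φ₃, ψ₀, …, ψ₃)`, with `φ_i` at `Sum.inl i` and `ψ_i` at `Sum.inr i`. -/
def spinBasis : Module.Basis (Fin 4 ⊕ Fin 4) ℂ S :=
  basisOfTopLeSpanOfCardEqFinrank spinVec spinVec_span (by simp [finrank_S])

/-- The dual basis elements `φ^i`. -/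
def φ (i : Fin 4) : Module.Dual ℂ S := spinBasis.coord (Sum.inl i)

/-- The dual basis elements `ψ^i`. -/
def ψ (i : Fin 4) : Module.Dual ℂ S := spinBasis.coord (Sum.inr i)

/-! ### The metric `η` and the Cayley form `Q` -/

/-- `η = φ⁰ψ⁰ + φ¹ψ¹ + φ²ψ² + φ³ψ³`, the symmetric bilinear form on `S` whose non-zero values on
basis vectors are `η(φ_i, ψ_i) = η(ψ_i, φ_i) = 1`. -/
def η : LinearMap.BilinForm ℂ S :=
  ∑ i : Fin 4, (LinearMap.BilinForm.linMulLin (φ i) (ψ i) +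
    LinearMap.BilinForm.linMulLin (ψ i) (φ i))

/-- `Λ⁴ S^*`. -/
abbrev FourForms : Type := ⋀[ℂ]^4 (Module.Dual ℂ S)

/-- The wedge product of four one-forms. -/
def wedge₄ (a b c d : Module.Dual ℂ S) : FourForms := exteriorPower.ιMulti ℂ 4 ![a, b, c, d]

/-- The Cayley `4`-form. -/
def Q : FourForms :=
  wedge₄ (φ 0) (φ 1) (ψ 0) (ψ 1) + wedge₄ (φ 0) (φ 2) (ψ 0) (ψ 2) + wedge₄ (φ 0) (φ 3) (ψ 0) (ψ 3)
  - wedge₄ (φ 1) (φ 2) (ψ 1) (ψ 2) - wedge₄ (φ 1) (φ 3) (ψ 1) (ψ 3)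
  - wedge₄ (φ 2) (φ 3) (ψ 2) (ψ 3)
  - (2 : ℂ) • wedge₄ (φ 0) (ψ 1) (ψ 2) (ψ 3) + (2 : ℂ) • wedge₄ (φ 1) (φ 2) (φ 3) (ψ 0)

/-! ### Hodge duality -/

lemma η_nondegenerate : η.Nondegenerate := by
  have hφ : ∀ i j, φ i (spinBasis (Sum.inl j)) = if j = i then 1 else 0 := fun i j => by
    simp [φ, Finsupp.single_apply]
  have hφ' : ∀ i j, φ i (spinBasis (Sum.inr j)) = 0 := fun i j => by
    simp [φ]
  have hψ : ∀ i j, ψ i (spinBasis (Sum.inr j)) = if j = i then 1 else 0 := fun i j => by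
    simp [ψ, Finsupp.single_apply]
  have hψ' : ∀ i j, ψ i (spinBasis (Sum.inl j)) = 0 := fun i j => by
    simp [ψ]
  have hr : ∀ s i, η s (spinBasis (Sum.inl i)) = ψ i s := fun s i => by
    simp [η, LinearMap.sum_apply, LinearMap.BilinForm.linMulLin_apply, hφ, hψ']
  have hr' : ∀ s i, η s (spinBasis (Sum.inr i)) = φ i s := fun s i => by
    simp [η, LinearMap.sum_apply, LinearMap.BilinForm.linMulLin_apply, hφ', hψ]
  have hsymm : ∀ s t, η s t = η t s := fun s t => by
    simp only [η, LinearMap.sum_apply, LinearMap.add_apply, LinearMap.BilinForm.linMulLin_apply]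
    exact Finset.sum_congr rfl fun i _ => by ring
  have hl : ∀ s, (∀ t, η s t = 0) → s = 0 := fun s h => by
    apply spinBasis.ext_elem
    rintro (i | i)
    · simpa [φ] using (hr' s i).symm.trans (h _)
    · simpa [ψ] using (hr s i).symm.trans (h _)
  exact ⟨hl, fun s h => hl s fun t => (hsymm s t).trans (h t)⟩

/-- The inverse of the musical isomorphism `♭ : S → S^*`, `s ↦ η(s, ·)`. -/
def sharp : Module.Dual ℂ S →ₗ[ℂ] S := (η.toDual η_nondegenerate).symm.toLinearMap

/-- The bilinear form induced by `η` on `Λ⁴ S^*`: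
`η(α₁∧…∧α₄, β₁∧…∧β₄) = det (α_i (β_j^♯))`. -/
def η₄ (α β : FourForms) : ℂ :=
  exteriorPower.pairingDual ℂ S 4 α (exteriorPower.map 4 sharp β)

/-- The volume form `φ⁰∧…∧φ³∧ψ⁰∧…∧ψ³` in `Λ⁸ S^*`, which is of unit length and defines the
orientation. -/
def vol : ExteriorAlgebra ℂ (Module.Dual ℂ S) :=
  ExteriorAlgebra.ιMulti ℂ 8 ![φ 0, φ 1, φ 2, φ 3, ψ 0, ψ 1, ψ 2, ψ 3]

/-- `β' = ⋆β`, that is, `α ∧ β' = η(α, β) vol` for all `4`-forms `α`. (Such a `β'` is unique,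
as the wedge product `Λ⁴ × Λ⁴ → Λ⁸` is a perfect pairing.) -/
def IsHodgeDual (β β' : FourForms) : Prop :=
  ∀ α : FourForms, (α : ExteriorAlgebra ℂ (Module.Dual ℂ S)) * β' = η₄ α β • vol

/-- `⋆β = -β`. -/
def IsAntiSelfDual (β : FourForms) : Prop := IsHodgeDual β (-β)

/-! ### The groups -/

/-- The conformal class `[w] = {λ w : λ ∈ ℂˣ}`. -/
def conformalClass {W : Type*} [AddCommGroup W] [Module ℂ W] (w : W) : Set W :=
  {x | ∃ c : ℂˣ, x = (c : ℂ) • w}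

/-- The elements of `GL(S)` that map a subset of a representation of `GL(S)` onto itself. -/
def stabilizer {W : Type*} [AddCommGroup W] [Module ℂ W] (r : Representation ℂ GLS W)
    (T : Set W) : Subgroup GLS where
  carrier := {A | r A '' T = T}
  one_mem' := by simp
  mul_mem' {A B} hA hB := by
    simp only [Set.mem_ofPred_eq] at *
    rw [map_mul, Module.End.coe_mul, Set.image_comp, hB, hA]
  inv_mem' {A} hA := by
    simp only [Set.mem_ofPred_eq] at *
    conv_lhs => rw [← hA]
    rw [← Set.image_comp, ← Module.End.coe_mul, ← map_mul]
    simp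

/-- The action of `GL(M)` on bilinear forms, `(A·β)(s,t) = β(A⁻¹s, A⁻¹t)`. -/
def actBilinGen (M : Type*) [AddCommGroup M] [Module ℂ M] :
    Representation ℂ (LinearMap.GeneralLinearGroup ℂ M) (LinearMap.BilinForm ℂ M) where
  toFun A :=
    { toFun := fun β => β.comp (↑A⁻¹ : M →ₗ[ℂ] M) (↑A⁻¹ : M →ₗ[ℂ] M)
      map_add' := fun _ _ => rfl
      map_smul' := fun _ _ => rfl }
  map_one' := by ext; simp
  map_mul' A B := by
    ext
    simp only [mul_inv_rev, Units.val_mul]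
    rfl

/-- The action of `GL(M)` on `Λ⁴ M^*`, `(A·ω)(s₁,…,s₄) = ω(A⁻¹s₁,…,A⁻¹s₄)`. -/
def actFourGen (M : Type*) [AddCommGroup M] [Module ℂ M] :
    Representation ℂ (LinearMap.GeneralLinearGroup ℂ M) (⋀[ℂ]^4 (Module.Dual ℂ M)) where
  toFun A := exteriorPower.map 4 ((↑A⁻¹ : M →ₗ[ℂ] M).dualMap)
  map_one' := by
    rw [inv_one, Units.val_one, Module.End.one_eq_id, LinearMap.dualMap_id, exteriorPower.map_id]
    rfl
  map_mul' A B := by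
    rw [mul_inv_rev, Units.val_mul, Module.End.mul_eq_comp, Module.End.mul_eq_comp,
      ← exteriorPower.map_comp, LinearMap.dualMap_comp_dualMap]

/-- The action of `GL(S)` on bilinear forms on `S`. -/
def actBilin : Representation ℂ GLS (LinearMap.BilinForm ℂ S) := actBilinGen S

/-- The action of `GL(S)` on `Λ⁴ S^*`. -/
def actFour : Representation ℂ GLS FourForms := actFourGen S

/-- `CO(S)`, the subgroup of `GL(S)` preserving the conformal class `[η]`. -/
def CO : Subgroup GLS := stabilizer actBilin (conformalClass η)

/-- `O(S)`, the isometry group of `η`. -/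
def O : Subgroup GLS where
  carrier := {A | ∀ s t : S, η ((A : S →ₗ[ℂ] S) s) ((A : S →ₗ[ℂ] S) t) = η s t}
  one_mem' := by simp
  mul_mem' {A B} hA hB := by
    intro s t
    rw [Units.val_mul, Module.End.mul_apply, Module.End.mul_apply, hA, hB]
  inv_mem' {A} hA := by
    intro s t
    rw [← hA]
    simp only [← Module.End.mul_apply, ← Units.val_mul, mul_inv_cancel]
    simp

/-- The group `ℂˣ · H` of all multiples `c h` with `c ∈ ℂˣ` and `h ∈ H`. -/
def scalarMul (H : Subgroup GLS) : Subgroup GLS where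
  carrier := {A | ∃ c : ℂˣ, ∃ h ∈ H, (A : S →ₗ[ℂ] S) = (c : ℂ) • (h : S →ₗ[ℂ] S)}
  one_mem' := ⟨1, 1, H.one_mem, by simp⟩
  mul_mem' := by
    rintro A B ⟨c, h, hh, hA⟩ ⟨d, k, hk, hB⟩
    refine ⟨c * d, h * k, H.mul_mem hh hk, ?_⟩
    simp [hA, hB, smul_smul, mul_comm]
  inv_mem' := by
    rintro A ⟨c, h, hh, hA⟩
    refine ⟨c⁻¹, h⁻¹, H.inv_mem hh, ?_⟩
    refine Units.inv_eq_of_mul_eq_one_right ?_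
    rw [hA]
    simp [smul_smul]

/-- The stabilizer in `CO(S)` of the conformal class `[Q]`. -/
def stabCayley : Subgroup GLS := CO ⊓ stabilizer actFour (conformalClass Q)

/-- `CSpin(7) = ℂˣ · Spin(7)`. -/
def CSpin7 : Subgroup GLS := scalarMul Spin7

end CayleySpin

end

/-! The spinors carry an embedding of `V` into the two-forms on `S`, namely v ↦ η(v·s, t), which is
skew because vectors act skewly for η. The Cayley form is, up to the factor -24 produced by the
normalizations, the Casimir element of this embedding: the sum of the products of the images of a
basis of `V` and of its g-dual basis (`casimir_eq`).

CSpin(7) stabilizes both classes: pulling back along the action of a vector u sends the two-form of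
v to that of q(u)v - B(u,v)u, B being the polar form of `q`, which for q(u) ≠ 0 is q(u) times the
reflection of v in u. So u multiplies the Casimir element by q(u)² and η by -q(u) (`map_casimir`,
`η_cliffordAction_cliffordAction`).

Conversely, rescale A so that it lies in O(S), with A^*Q = cQ. Contraction with Q is an operator on
the 28-dimensional space of two-forms. Its only eigenvalues are -6, whose eigenspace is exactly the
7-dimensional image of `V`, and 2, on a space of dimension 21 (`eigenvalue_cayleyOp`,
`exists_eq_twoForm`). Contraction is natural for isometries, so A^* carries the image of `V` to
eigenvectors with eigenvalue -6/c. Hence c is 1 or -3; the same holds for c⁻¹, so c = 1. Then A^*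
preserves the image of `V`, which says that conjugation by A⁻¹ preserves `V` inside End(S) and
induces an isometry h of (V, q). By Cartan–Dieudonné (`isPinLift_of_isometry`) h comes from an
element x of the pin group, and A·x commutes or anticommutes with all vectors. By Schur's lemma in
the form of `exists_eq_smul_one_of_commute` and `eq_zero_of_anticommute`, A·x is a scalar and x is
even, so A is a multiple of a spin element.

Faithfulness follows from the fact that even elements commuting with `V` are scalars.
Anti-self-duality is checked on the eight monomials of Q. -/

noncomputable section

/-! ### Exterior algebra: the common kernel of all contractions. -/

namespace ExteriorAlgebra

variable {R M : Type*} [CommRing R] [AddCommGroup M] [Module R M]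

/-- An element of a free exterior algebra of finite rank that is killed by all contractions
is a scalar. -/
theorem eq_algebraMap_of_contractLeft_eq_zero {n : ℕ} (b : Module.Basis (Fin n) R M)
    (x : ExteriorAlgebra R M)
    (hx : ∀ d : Module.Dual R M,
      CliffordAlgebra.contractLeft (Q := (0 : QuadraticForm R M)) d x = 0) :
    x = algebraMap R _ (algebraMapInv x) := by
  let E : List (Fin n) → ExteriorAlgebra R M := fun l => (l.map fun i => ι R (b i)).prod
  have hd : ∀ (d : Module.Dual R M) (m : M) (y : ExteriorAlgebra R M),
      CliffordAlgebra.contractLeft (Q := (0 : QuadraticForm R M)) d (ι R m * y) =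
        d m • y - ι R m * CliffordAlgebra.contractLeft (Q := (0 : QuadraticForm R M)) d y :=
    fun d m y => CliffordAlgebra.contractLeft_ι_mul (Q := (0 : QuadraticForm R M)) d m y
  have hE : ∀ i (l : List (Fin n)), i ∈ l → E l * ι R (b i) = 0 := by
    intro i l
    induction l with
    | nil => simp
    | cons j l ih =>
      intro hi
      have hcons : E (j :: l) = ι R (b j) * E l := by simp [E]
      rw [hcons, mul_assoc]
      by_cases h : i ∈ l
      · rw [ih h, mul_zero]
      · obtain rfl : i = j := by simpa [h] using hi
        have hcomm : ∀ l' : List (Fin n), ∃ u, E l' * ι R (b i) = ι R (b i) * u := by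
          intro l'
          induction l' with
          | nil => exact ⟨1, by simp [E]⟩
          | cons k l' ih' =>
            obtain ⟨u, hu⟩ := ih'
            refine ⟨-(ι R (b k) * u), ?_⟩
            have hk : E (k :: l') = ι R (b k) * E l' := by simp [E]
            rw [hk, mul_assoc, hu, ← mul_assoc,
              eq_neg_of_add_eq_zero_left (ι_add_mul_swap (b k) (b i))]
            simp [mul_assoc]
        obtain ⟨u, hu⟩ := hcomm l
        rw [hu, ← mul_assoc, ι_sq_zero, zero_mul]
  -- Multiplication by the product of all basis vectors kills everything of positive degree, so only
  -- the scalar part of y survives.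
  have hE' : ∀ y : ExteriorAlgebra R M,
      E (List.finRange n) * y = algebraMapInv y • E (List.finRange n) := by
    intro y
    induction y using CliffordAlgebra.left_induction with
    | algebraMap r =>
      have h : algebraMapInv (algebraMap R (ExteriorAlgebra R M) r) = r :=
        algebraMap_leftInverse M r
      refine Eq.trans ?_ (congrArg (· • E (List.finRange n)) h.symm)
      exact (Algebra.commutes _ _).symm.trans (Algebra.smul_def _ _).symm
    | add x y hx hy => rw [mul_add, hx, hy, map_add, add_smul]
    | ι_mul x m hx =>
      have h0 : E (List.finRange n) * ι R m = 0 := by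
        rw [← b.sum_repr m, map_sum, Finset.mul_sum]
        exact Finset.sum_eq_zero fun i _ => by
          rw [map_smul, mul_smul_comm, hE i _ (List.mem_finRange i), smul_zero]
      have h1 : algebraMapInv (ι R m) = 0 := by simp [algebraMapInv]
      change E (List.finRange n) * (ι R m * x) = algebraMapInv (ι R m * x) • _
      rw [← mul_assoc, h0, map_mul, h1]
      simp
  set y := x - algebraMap R _ (algebraMapInv x) with hy
  have hy0 : algebraMapInv y = 0 := by
    rw [hy, map_sub, algebraMap_leftInverse M (algebraMapInv x), sub_self]
  have hyd : ∀ d, CliffordAlgebra.contractLeft (Q := (0 : QuadraticForm R M)) d y = 0 := by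
    intro d
    rw [hy, map_sub, hx]
    simp [CliffordAlgebra.contractLeft_algebraMap (Q := (0 : QuadraticForm R M)) d]
  have hkill : ∀ i (l : List (Fin n)), i ∉ l →
      CliffordAlgebra.contractLeft (Q := (0 : QuadraticForm R M)) (b.coord i) (E l * y) = 0 := by
    intro i l
    induction l with
    | nil => intro _; simpa [E] using hyd (b.coord i)
    | cons j l ih =>
      intro hi
      rw [List.mem_cons, not_or] at hi
      have : E (j :: l) * y = ι R (b j) * (E l * y) := by simp [E, mul_assoc]
      rw [this, hd, ih hi.2]
      simp [Ne.symm hi.1]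
  -- Basis vectors are stripped off one at a time: contracting ι(b i) * (E l * y) = 0 with the i-th
  -- coordinate returns E l * y, the other Leibniz term being zero by `hkill`. The start is the full
  -- product, which kills y because y has no scalar part.
  have hinj : ∀ l : List (Fin n), l.Nodup → E l * y = 0 → y = 0 := by
    intro l
    induction l with
    | nil => intro _ h; simpa [E] using h
    | cons i l ih =>
      intro hl h
      rw [List.nodup_cons] at hl
      refine ih hl.2 ?_
      have h1 : E (i :: l) * y = ι R (b i) * (E l * y) := by simp [E, mul_assoc]
      have h2 := hd (b.coord i) (b i) (E l * y)
      rw [← h1, h, hkill i l hl.1] at h2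
      simpa using h2.symm
  exact sub_eq_zero.1 (hinj _ (List.nodup_finRange n) (by rw [hE', hy0, zero_smul]))

end ExteriorAlgebra

namespace CliffordAlgebra

/-! ### Even elements of a Clifford algebra that commute with all vectors. -/

section Center

variable {R M : Type*} [CommRing R] [AddCommGroup M] [Module R M] {Q : QuadraticForm R M}

/-- The supercommutator with a vector is a contraction. -/
theorem ι_mul_sub_involute_mul_ι (v : M) (x : CliffordAlgebra Q) :
    ι Q v * x - involute x * ι Q v = contractLeft (QuadraticMap.polarBilin Q v) x := by
  induction x using left_induction with
  | algebraMap r =>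
    rw [contractLeft_algebraMap, AlgHom.commutes, Algebra.commutes, sub_self]
  | add x y hx hy => rw [map_add, map_add, ← hx, ← hy]; noncomm_ring
  | ι_mul x m hx =>
    rw [contractLeft_ι_mul, ← hx, map_mul, involute_ι, ← mul_assoc,
      eq_sub_of_add_eq (ι_mul_ι_add_swap v m), sub_mul, ← Algebra.smul_def,
      QuadraticMap.polarBilin_apply_apply]
    noncomm_ring

/-- If the polar form is non-degenerate, the only even elements that commute with all vectors
are the scalars. -/
theorem exists_eq_algebraMap_of_commute [Invertible (2 : R)] {n : ℕ} (b : Module.Basis (Fin n) R M)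
    (hQ : Function.Surjective (QuadraticMap.polarBilin Q)) {x : CliffordAlgebra Q}
    (hx : involute x = x) (hc : ∀ v, ι Q v * x = x * ι Q v) :
    ∃ r, x = algebraMap R _ r := by
  -- By non-degeneracy every contraction is a supercommutator with a vector, and for an even x this
  -- is a commutator.
  have h0 : ∀ d : Module.Dual R M, contractLeft d x = 0 := by
    intro d
    obtain ⟨v, rfl⟩ := hQ d
    rw [← ι_mul_sub_involute_mul_ι, hx, hc, sub_self]
  refine ⟨ExteriorAlgebra.algebraMapInv (equivExterior Q x), (equivExterior Q).injective ?_⟩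
  refine (ExteriorAlgebra.eq_algebraMap_of_contractLeft_eq_zero b (equivExterior Q x) ?_).trans ?_
  · intro d
    exact (changeForm_contractLeft changeForm.associated_neg_proof d x).symm.trans
      (by rw [h0, map_zero])
  · exact (changeForm_algebraMap changeForm.associated_neg_proof _).symm

end Center

/-! ### Reflections, the pin group and the theorem of Cartan–Dieudonné. -/

section PinLift

variable {V : Type*} [AddCommGroup V] [Module ℂ V] {Q : QuadraticForm ℂ V}

/-- `x` in the pin group induces the linear map `h` by twisted conjugation. -/
def IsPinLift (Q : QuadraticForm ℂ V) (h : V →ₗ[ℂ] V) : Prop :=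
  ∃ x ∈ pinGroup Q, ∃ s : ℂ, (s = 1 ∨ s = -1) ∧ involute x = s • x ∧
    ∀ v, x * ι Q v = s • (ι Q (h v) * x)

/-- The reflection in a non-isotropic vector. -/
def reflection (Q : QuadraticForm ℂ V) (u : V) : V →ₗ[ℂ] V :=
  LinearMap.id - ((Q u)⁻¹ • QuadraticMap.polarBilin Q u).smulRight u

lemma reflection_apply (u v : V) :
    reflection Q u v = v - ((Q u)⁻¹ * QuadraticMap.polarBilin Q u v) • u := by
  simp [reflection]

lemma polarBilin_self (v : V) : QuadraticMap.polarBilin Q v v = 2 * Q v := by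
  simp [QuadraticMap.polar_self]

lemma polarBilin_comm (v w : V) :
    QuadraticMap.polarBilin Q v w = QuadraticMap.polarBilin Q w v := by
  simp [QuadraticMap.polar_comm]

lemma map_add_eq (v w : V) : Q (v + w) = Q v + Q w + QuadraticMap.polarBilin Q v w := by
  simp [QuadraticMap.polar]

lemma map_sub_eq (v w : V) : Q (v - w) = Q v + Q w - QuadraticMap.polarBilin Q v w := by
  rw [sub_eq_add_neg, map_add_eq, QuadraticMap.map_neg, map_neg, sub_eq_add_neg]

lemma map_reflection {u : V} (hu : Q u ≠ 0) (v : V) : Q (reflection Q u v) = Q v := by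
  rw [reflection_apply, map_sub_eq, QuadraticMap.map_smul, map_smul, polarBilin_comm v u,
    smul_eq_mul, smul_eq_mul]
  field_simp
  ring

lemma reflection_reflection {u : V} (hu : Q u ≠ 0) (v : V) :
    reflection Q u (reflection Q u v) = v := by
  simp only [reflection_apply, map_sub, map_smul, polarBilin_self]
  match_scalars
  · rfl
  · field_simp
    ring

lemma reflection_of_polar_eq_zero {u v : V} (h : QuadraticMap.polarBilin Q u v = 0) :
    reflection Q u v = v := by
  simp [reflection_apply, h]

lemma IsPinLift.id : IsPinLift Q LinearMap.id :=
  ⟨1, one_mem _, 1, Or.inl rfl, by simp, fun v => by simp⟩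

lemma IsPinLift.comp {h h' : V →ₗ[ℂ] V} (H : IsPinLift Q h) (H' : IsPinLift Q h') :
    IsPinLift Q (h ∘ₗ h') := by
  obtain ⟨x, hx, s, hs, hi, hc⟩ := H
  obtain ⟨x', hx', s', hs', hi', hc'⟩ := H'
  refine ⟨x * x', mul_mem hx hx', s * s', ?_, ?_, fun v => ?_⟩
  · rcases hs with rfl | rfl <;> rcases hs' with rfl | rfl <;> simp
  · rw [map_mul, hi, hi', smul_mul_smul_comm]
  · rw [mul_assoc, hc', mul_smul_comm, ← mul_assoc, hc, smul_mul_assoc, smul_smul, mul_comm s',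
      mul_assoc, LinearMap.comp_apply]

/-- The star operation negates vectors, so u times its star is -Q(u), and unitarity requires Q(u) =
-1. For Q = `q` this is g(u,u) = 1. -/
lemma ι_mem_pinGroup {u : V} (hu : Q u = -1) : ι Q u ∈ pinGroup Q := by
  have hsq : ι Q u * ι Q u = -1 := by rw [ι_sq_scalar, hu, map_neg, map_one]
  let y : (CliffordAlgebra Q)ˣ :=
    ⟨ι Q u, -ι Q u, by rw [mul_neg, hsq, neg_neg], by rw [neg_mul, hsq, neg_neg]⟩
  refine ⟨⟨y, Subgroup.subset_closure ⟨u, rfl⟩, rfl⟩, ?_, ?_⟩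
  · rw [star_ι, neg_mul, hsq, neg_neg]
  · rw [star_ι, mul_neg, hsq, neg_neg]

lemma isPinLift_reflection {u : V} (hu : Q u ≠ 0) : IsPinLift Q (reflection Q u) := by
  -- A complex square root c of -1/Q(u) rescales u to a vector of value -1, without changing its
  -- reflection.
  obtain ⟨c, hc⟩ := IsAlgClosed.exists_eq_mul_self (-(Q u)⁻¹)
  have hcu : Q (c • u) = -1 := by
    rw [QuadraticMap.map_smul, ← hc, smul_eq_mul, neg_mul, inv_mul_cancel₀ hu]
  refine ⟨ι Q (c • u), ι_mem_pinGroup hcu, -1, Or.inr rfl, by simp, fun v => ?_⟩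
  have hsq : ι Q (c • u) * ι Q (c • u) = -1 := by rw [ι_sq_scalar, hcu, map_neg, map_one]
  have href : reflection Q u v = v + QuadraticMap.polar Q (c • u) v • (c • u) := by
    rw [reflection_apply, QuadraticMap.polar_smul_left, QuadraticMap.polarBilin_apply_apply,
      smul_smul, smul_eq_mul]
    have : c * QuadraticMap.polar Q u v * c = -((Q u)⁻¹ * QuadraticMap.polar Q u v) := by
      rw [mul_right_comm, ← hc]; ring
    rw [this]
    module
  generalize c • u = w at hsq href ⊢
  rw [href, map_add, map_smul, add_mul, smul_mul_assoc, hsq,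
    eq_sub_of_add_eq (ι_mul_ι_add_swap w v), Algebra.algebraMap_eq_smul_one]
  module

/-- **Cartan–Dieudonné**: a linear isometry of a non-degenerate complex quadratic space is induced
by an element of the pin group. -/
theorem isPinLift_of_isometry {n : ℕ} (b : Module.Basis (Fin n) ℂ V)
    (hb : ∀ i j, i ≠ j → QuadraticMap.polarBilin Q (b i) (b j) = 0) (hb' : ∀ i, Q (b i) ≠ 0)
    (h : V →ₗ[ℂ] V) (hh : ∀ v, Q (h v) = Q v) : IsPinLift Q h := by
  have hpol : ∀ h : V →ₗ[ℂ] V, (∀ v, Q (h v) = Q v) → ∀ v w,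
      QuadraticMap.polarBilin Q (h v) (h w) = QuadraticMap.polarBilin Q v w := by
    intro h hh v w
    simp only [QuadraticMap.polarBilin_apply_apply, QuadraticMap.polar, ← map_add, hh]
  -- Induction on the number m of basis vectors not known to be fixed: the first n - m are fixed.
  -- For m = n nothing is assumed.
  suffices H : ∀ m, ∀ h : V →ₗ[ℂ] V, (∀ v, Q (h v) = Q v) →
      (∀ j : Fin n, j.val + m < n → h (b j) = b j) → IsPinLift Q h from
    H n h hh fun j hj => absurd hj (by omega)
  intro m
  induction m with
  | zero =>
    intro h _ hfix
    have : h = LinearMap.id := b.ext fun j => hfix j j.isLt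
    rw [this]
    exact IsPinLift.id
  | succ m ih =>
    intro h hh hfix
    by_cases hm : m + 1 ≤ n
    swap
    · exact ih h hh fun j hj => absurd hj (by omega)
    set i : Fin n := ⟨n - (m + 1), by omega⟩ with hi
    have hlt : ∀ j : Fin n, j.val + m < n → j = i ∨ (j ≠ i ∧ h (b j) = b j) := by
      intro j hj
      by_cases hji : j = i
      · exact Or.inl hji
      · have : j.val ≠ n - (m + 1) := fun h => hji (Fin.ext h)
        exact Or.inr ⟨hji, hfix j (by omega)⟩
    have horth : ∀ j, j ≠ i → h (b j) = b j →
        QuadraticMap.polarBilin Q (h (b i)) (b j) = 0 := by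
      intro j hj hf
      conv_lhs => rw [← hf]
      rw [hpol h hh, hb i j hj.symm]
    by_cases hu : Q (h (b i) - b i) = 0
    -- The parallelogram law Q(hb + b) + Q(hb - b) = 4 Q(b) shows that the sum is non-isotropic when
    -- the difference is isotropic. Reflecting in the sum sends hb to -b, and reflecting in b
    -- corrects the sign. Basis vectors already fixed are orthogonal to both mirrors and stay fixed.
    · have hu' : Q (h (b i) + b i) ≠ 0 := by
        intro h0
        rw [map_sub_eq, hh] at hu
        rw [map_add_eq, hh] at h0
        exact hb' i (by linear_combination (hu + h0) / 4)
      have hr : reflection Q (h (b i) + b i) (h (b i)) = -b i := by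
        rw [reflection_apply]
        have : QuadraticMap.polarBilin Q (h (b i) + b i) (h (b i)) = Q (h (b i) + b i) := by
          rw [map_add_eq, map_add, LinearMap.add_apply, polarBilin_self, hh,
            polarBilin_comm (b i)]
          ring
        rw [this, inv_mul_cancel₀ hu']
        module
      have hrb : reflection Q (b i) (-b i) = b i := by
        rw [reflection_apply, map_neg, polarBilin_self]
        have : (Q (b i))⁻¹ * -(2 * Q (b i)) = -2 := by field_simp [hb' i]
        rw [this]
        module
      have hl := ih (reflection Q (b i) ∘ₗ reflection Q (h (b i) + b i) ∘ₗ h)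
        (fun v => by simp only [LinearMap.comp_apply, map_reflection (hb' i),
          map_reflection hu', hh])
        (fun j hj => by
          rcases hlt j hj with rfl | ⟨hji, hf⟩
          · simp only [LinearMap.comp_apply, hr, hrb]
          · rw [LinearMap.comp_apply, LinearMap.comp_apply, hf,
              reflection_of_polar_eq_zero (u := h (b i) + b i),
              reflection_of_polar_eq_zero (hb i j hji.symm)]
            rw [map_add, LinearMap.add_apply, horth j hji hf, hb i j hji.symm, add_zero])
      have := (isPinLift_reflection hu').comp ((isPinLift_reflection (hb' i)).comp hl)
      convert this using 1
      ext v
      simp only [LinearMap.comp_apply, reflection_reflection (hb' i), reflection_reflection hu']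
    -- Since hb and b have the same value under Q, the reflection in their difference exchanges
    -- them.
    · have hr : reflection Q (h (b i) - b i) (h (b i)) = b i := by
        rw [reflection_apply]
        have : QuadraticMap.polarBilin Q (h (b i) - b i) (h (b i)) = Q (h (b i) - b i) := by
          rw [map_sub_eq, map_sub, LinearMap.sub_apply, polarBilin_self, hh,
            polarBilin_comm (b i)]
          ring
        rw [this, inv_mul_cancel₀ hu]
        module
      have hl := ih (reflection Q (h (b i) - b i) ∘ₗ h)
        (fun v => by simp only [LinearMap.comp_apply, map_reflection hu, hh])
        (fun j hj => by
          rcases hlt j hj with rfl | ⟨hji, hf⟩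
          · simp only [LinearMap.comp_apply, hr]
          · rw [LinearMap.comp_apply, hf, reflection_of_polar_eq_zero]
            rw [map_sub, LinearMap.sub_apply, horth j hji hf, hb i j hji.symm, sub_zero])
      have := (isPinLift_reflection hu).comp hl
      convert this using 1
      ext v
      simp only [LinearMap.comp_apply, reflection_reflection hu]

end PinLift

end CliffordAlgebra

namespace CayleySpin

/-! ### The quadratic form on `V` -/

lemma polarBilin_q (v w : V) :
    QuadraticMap.polarBilin q v w = -2 * ∑ i : Fin 7, v i * w i.rev := by
  have : ∀ i : Fin 7, i.rev = ![6, 5, 4, 3, 2, 1, 0] i := by decide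
  simp only [QuadraticMap.polarBilin_apply_apply, QuadraticMap.polar, q_apply, Pi.add_apply,
    Fin.sum_univ_seven, this]
  simp
  ring

lemma polarBilin_q_single (v : V) (i : Fin 7) :
    QuadraticMap.polarBilin q v (Pi.single i.rev 1) = -2 * v i := by
  rw [polarBilin_q, Finset.sum_eq_single i]
  · simp
  · intro j _ hj
    rw [Pi.single_eq_of_ne (by simpa using hj), mul_zero]
  · simp

lemma polarBilin_q_surjective : Function.Surjective (QuadraticMap.polarBilin q) := by
  intro d
  refine ⟨fun i => -(1 / 2) * d (Pi.single i.rev 1), ?_⟩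
  refine LinearMap.pi_ext' fun i => LinearMap.ext_ring ?_
  have := polarBilin_q_single (fun i => -(1 / 2) * d (Pi.single i.rev 1)) i.rev
  rw [Fin.rev_rev] at this
  simp only [LinearMap.comp_apply, LinearMap.single_apply]
  rw [this]
  ring

lemma eq_zero_of_polarBilin_q_eq_zero {v : V} (h : ∀ w, QuadraticMap.polarBilin q v w = 0) :
    v = 0 := by
  funext i
  have := polarBilin_q_single v i
  rw [h] at this
  simpa using this

/-- The given basis of `V` has isotropic members, while `isPinLift_of_isometry` needs an orthogonal
one without them. An isotropic member of an orthogonal basis would be orthogonal to all of `V`. -/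
lemma exists_orthogonal_basis_q : ∃ (n : ℕ) (b : Module.Basis (Fin n) ℂ V),
    (∀ i j, i ≠ j → QuadraticMap.polarBilin q (b i) (b j) = 0) ∧ ∀ i, q (b i) ≠ 0 := by
  have hs : (QuadraticMap.polarBilin q).IsSymm :=
    ⟨fun x y => by simp [QuadraticMap.polar_comm]⟩
  obtain ⟨b, hb⟩ := LinearMap.BilinForm.exists_orthogonal_basis hs
  refine ⟨_, b, fun i j hij => hb hij, fun i hi => b.ne_zero i ?_⟩
  refine eq_zero_of_polarBilin_q_eq_zero fun w => ?_
  rw [← b.sum_repr w, map_sum]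
  refine Finset.sum_eq_zero fun j _ => ?_
  rw [map_smul]
  by_cases hij : i = j
  · subst hij
    rw [CliffordAlgebra.polarBilin_self, hi, mul_zero, smul_zero]
  · rw [show QuadraticMap.polarBilin q (b i) (b j) = 0 from hb hij, smul_zero]

/-! ### The Clifford action on the basis of spinors -/

lemma spinBasis_apply (k : Fin 4 ⊕ Fin 4) : spinBasis k = spinVec k := by
  simp [spinBasis]

lemma interior_one (e : E) : interior e 1 = 0 :=
  CliffordAlgebra.contractLeft_one (Q := (0 : QuadraticForm ℂ (Module.Dual ℂ E)))
    (Module.Dual.eval ℂ E e)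

lemma interior_ε_mul (e : E) (i : Fin 3) (x : S) :
    interior e (ε i * x) = e i • x - ε i * interior e x := by
  have := LinearMap.congr_fun (interior_exterior e (dualE i)) x
  simp only [Module.End.mul_apply, LinearMap.sub_apply, LinearMap.smul_apply,
    Module.End.one_apply] at this
  exact this

lemma interior_ε (e : E) (i : Fin 3) : interior e (ε i) = e i • 1 := by
  have := interior_ε_mul e i 1
  rwa [mul_one, interior_one, mul_zero, sub_zero] at this

lemma parity_one : parity 1 = 1 := by simp [parity]

lemma parity_ε_mul (i : Fin 3) (x : S) : parity (ε i * x) = -(ε i * parity x) := by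
  have := LinearMap.congr_fun (parity_exterior (dualE i)) x
  simp only [Module.End.mul_apply, LinearMap.neg_apply] at this
  exact this

lemma parity_ε (i : Fin 3) : parity (ε i) = -ε i := by
  have := parity_ε_mul i 1
  rwa [mul_one, parity_one, mul_one] at this

lemma cliffordAction_apply (v : V) (x : S) : cliffordAction v x =
    -(Real.sqrt 2 : ℂ) • interior (projE v) x
    + (Real.sqrt 2 : ℂ) • ((v 6 • ε 0 + v 5 • ε 1 + v 4 • ε 2) * x)
    + (v 3 * Complex.I) • parity x := by
  simp [cliffordAction, exterior, flatF, ε]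

lemma projE_apply_zero (v : V) : projE v 0 = v 0 := rfl
lemma projE_apply_one (v : V) : projE v 1 = v 1 := rfl
lemma projE_apply_two (v : V) : projE v 2 = v 2 := rfl

lemma ε_one_zero : ε 1 * ε 0 = -(ε 0 * ε 1) := ε_swap _ _
lemma ε_two_zero : ε 2 * ε 0 = -(ε 0 * ε 2) := ε_swap _ _
lemma ε_two_one : ε 2 * ε 1 = -(ε 1 * ε 2) := ε_swap _ _

lemma ε_mul_self_mul (i : Fin 3) (x : S) : ε i * (ε i * x) = 0 := by
  rw [← mul_assoc, ε_sq, zero_mul]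

lemma ε_one_zero_mul (x : S) : ε 1 * (ε 0 * x) = -(ε 0 * (ε 1 * x)) := by
  rw [← mul_assoc, ε_one_zero, neg_mul, mul_assoc]
lemma ε_two_zero_mul (x : S) : ε 2 * (ε 0 * x) = -(ε 0 * (ε 2 * x)) := by
  rw [← mul_assoc, ε_two_zero, neg_mul, mul_assoc]
lemma ε_two_one_mul (x : S) : ε 2 * (ε 1 * x) = -(ε 1 * (ε 2 * x)) := by
  rw [← mul_assoc, ε_two_one, neg_mul, mul_assoc]

/-- This multiplication table enters the later computations only through `twoForm_eq`. -/
lemma cliffordAction_spinVec (v : V) (k : Fin 4 ⊕ Fin 4) : cliffordAction v (spinVec k) =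
    Sum.elim
      ![(Real.sqrt 2 : ℂ) • (v 6 • spinVec (.inl 1) + v 5 • spinVec (.inl 2)
            + v 4 • spinVec (.inl 3)) + (v 3 * Complex.I) • spinVec (.inl 0),
        (Real.sqrt 2 : ℂ) • (-(v 0 • spinVec (.inl 0)) - v 5 • spinVec (.inr 3)
            + v 4 • spinVec (.inr 2)) - (v 3 * Complex.I) • spinVec (.inl 1),
        (Real.sqrt 2 : ℂ) • (-(v 1 • spinVec (.inl 0)) + v 6 • spinVec (.inr 3)
            - v 4 • spinVec (.inr 1)) - (v 3 * Complex.I) • spinVec (.inl 2),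
        (Real.sqrt 2 : ℂ) • (-(v 2 • spinVec (.inl 0)) - v 6 • spinVec (.inr 2)
            + v 5 • spinVec (.inr 1)) - (v 3 * Complex.I) • spinVec (.inl 3)]
      ![(Real.sqrt 2 : ℂ) • (v 0 • spinVec (.inr 1) + v 1 • spinVec (.inr 2)
            + v 2 • spinVec (.inr 3)) - (v 3 * Complex.I) • spinVec (.inr 0),
        (Real.sqrt 2 : ℂ) • (v 2 • spinVec (.inl 2) - v 1 • spinVec (.inl 3)
            - v 6 • spinVec (.inr 0)) + (v 3 * Complex.I) • spinVec (.inr 1),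
        (Real.sqrt 2 : ℂ) • (v 0 • spinVec (.inl 3) - v 2 • spinVec (.inl 1)
            - v 5 • spinVec (.inr 0)) + (v 3 * Complex.I) • spinVec (.inr 2),
        (Real.sqrt 2 : ℂ) • (v 1 • spinVec (.inl 1) - v 0 • spinVec (.inl 2)
            - v 4 • spinVec (.inr 0)) + (v 3 * Complex.I) • spinVec (.inr 3)] k := by
  rcases k with k | k <;> fin_cases k <;>
    simp [spinVec, cliffordAction_apply, interior_one, interior_ε, interior_ε_mul, parity_one,
      parity_ε, parity_ε_mul, ε_sq, ε_one_zero, ε_two_zero, ε_two_one, ε_one_zero_mul,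
      ε_two_zero_mul, ε_two_one_mul, ε_mul_self_mul, mul_assoc, add_mul, projE_apply_zero,
      projE_apply_one, projE_apply_two, mul_sub] <;>
    module

/-! ### The two-forms attached to vectors -/

lemma φ_inl (i j : Fin 4) : φ i (spinBasis (Sum.inl j)) = if j = i then 1 else 0 := by
  simp [φ, Finsupp.single_apply]

lemma φ_inr (i j : Fin 4) : φ i (spinBasis (Sum.inr j)) = 0 := by
  simp [φ]

lemma ψ_inr (i j : Fin 4) : ψ i (spinBasis (Sum.inr j)) = if j = i then 1 else 0 := by
  simp [ψ, Finsupp.single_apply]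

lemma ψ_inl (i j : Fin 4) : ψ i (spinBasis (Sum.inl j)) = 0 := by
  simp [ψ]

lemma η_comm (s t : S) : η s t = η t s := by
  simp only [η, LinearMap.sum_apply, LinearMap.add_apply, LinearMap.BilinForm.linMulLin_apply]
  exact Finset.sum_congr rfl fun i _ => by ring

lemma η_inl (i : Fin 4) (t : S) : η (spinBasis (.inl i)) t = ψ i t := by
  simp [η, LinearMap.sum_apply, LinearMap.BilinForm.linMulLin_apply, φ_inl, ψ_inl]

lemma η_inr (i : Fin 4) (t : S) : η (spinBasis (.inr i)) t = φ i t := by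
  simp [η, LinearMap.sum_apply, LinearMap.BilinForm.linMulLin_apply, φ_inr, ψ_inr]

lemma eq_of_η_eq {s s' : S} (h : ∀ t, η s t = η s' t) : s = s' :=
  sub_eq_zero.1 (η_nondegenerate.1 _ fun t => by
    rw [map_sub, LinearMap.sub_apply, h, sub_self])

/-- The wedge product of two one-forms, as a bilinear form. -/
def wedge₂ (a b : Module.Dual ℂ S) : LinearMap.BilinForm ℂ S :=
  LinearMap.BilinForm.linMulLin a b - LinearMap.BilinForm.linMulLin b a

lemma wedge₂_apply (a b : Module.Dual ℂ S) (s t : S) :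
    wedge₂ a b s t = a s * b t - b s * a t := by
  simp [wedge₂, LinearMap.BilinForm.linMulLin_apply]

/-- The two-form `(s, t) ↦ η(v · s, t)`. -/
def twoForm : V →ₗ[ℂ] LinearMap.BilinForm ℂ S where
  toFun v := η ∘ₗ cliffordAction v
  map_add' v w := by rw [map_add, LinearMap.comp_add]
  map_smul' c v := by rw [map_smul, LinearMap.comp_smul, RingHom.id_apply]

lemma twoForm_apply (v : V) (s t : S) : twoForm v s t = η (cliffordAction v s) t := rfl

lemma twoForm_eq (v : V) : twoForm v =
    (Real.sqrt 2 : ℂ) • (v 6 • (wedge₂ (φ 0) (ψ 1) + wedge₂ (φ 2) (φ 3))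
      + v 5 • (wedge₂ (φ 0) (ψ 2) + wedge₂ (φ 3) (φ 1))
      + v 4 • (wedge₂ (φ 0) (ψ 3) + wedge₂ (φ 1) (φ 2))
      - v 0 • (wedge₂ (φ 1) (ψ 0) - wedge₂ (ψ 2) (ψ 3))
      - v 1 • (wedge₂ (φ 2) (ψ 0) - wedge₂ (ψ 3) (ψ 1))
      - v 2 • (wedge₂ (φ 3) (ψ 0) - wedge₂ (ψ 1) (ψ 2)))
    + (v 3 * Complex.I) • (wedge₂ (φ 0) (ψ 0) - wedge₂ (φ 1) (ψ 1) - wedge₂ (φ 2) (ψ 2)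
      - wedge₂ (φ 3) (ψ 3)) := by
  refine spinBasis.ext fun k => LinearMap.ext fun t => ?_
  rw [twoForm_apply, spinBasis_apply, cliffordAction_spinVec]
  rcases k with k | k <;> fin_cases k <;>
    simp [← spinBasis_apply, wedge₂_apply, η_inl, η_inr, φ_inl, φ_inr, ψ_inl, ψ_inr] <;>
    ring

lemma twoForm_swap (v : V) (s t : S) : twoForm v t s = -twoForm v s t := by
  rw [twoForm_eq]
  simp [wedge₂_apply]
  ring

lemma η_cliffordAction (v : V) (s t : S) :
    η (cliffordAction v s) t = -η s (cliffordAction v t) := by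
  rw [← twoForm_apply, twoForm_swap, twoForm_apply, η_comm]

/-! ### Irreducibility of the spin representation -/

lemma cliffordAction_mul_add (v w : V) :
    cliffordAction v * cliffordAction w + cliffordAction w * cliffordAction v =
      QuadraticMap.polarBilin q v w • (1 : Module.End ℂ S) := by
  have h := cliffordAction_sq (v + w)
  rw [map_add, CliffordAlgebra.map_add_eq, map_add, map_add, add_mul, mul_add, mul_add,
    cliffordAction_sq, cliffordAction_sq, Algebra.algebraMap_eq_smul_one (QuadraticMap.polarBilin q v w)] at h
  rw [← add_right_inj (algebraMap ℂ (Module.End ℂ S) (q v) + algebraMap ℂ (Module.End ℂ S) (q w)),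
    ← h]
  abel

lemma cliffordAction_injective : Function.Injective cliffordAction := by
  rw [injective_iff_map_eq_zero]
  intro v hv
  refine eq_zero_of_polarBilin_q_eq_zero fun w => ?_
  have h := LinearMap.congr_fun (cliffordAction_mul_add v w) (spinBasis (.inl 0))
  rw [hv, zero_mul, mul_zero, add_zero] at h
  simpa [spinBasis.ne_zero] using h.symm

/-- The element 1 is the vacuum vector, unique up to scale, of the spinor module. An operator that
commutes or anticommutes with `V` must map it to a multiple of itself. -/
lemma exists_smul_one_of_interior_eq_zero {y : S} (hy : ∀ e, interior e y = 0) :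
    ∃ r : ℂ, y = r • 1 := by
  refine ⟨ExteriorAlgebra.algebraMapInv y, ?_⟩
  rw [← Algebra.algebraMap_eq_smul_one]
  refine ExteriorAlgebra.eq_algebraMap_of_contractLeft_eq_zero
    (Pi.basisFun ℂ (Fin 3)).dualBasis y fun d => ?_
  obtain ⟨e, rfl⟩ := (Module.evalEquiv ℂ E).surjective d
  exact hy e

section Schur

variable {B : Module.End ℂ S} {σ : ℂ}
  (hB : ∀ v, B * cliffordAction v = σ • (cliffordAction v * B))

include hB

/-- The scalar σ will be 1 for commuting and -1 for anticommuting operators. The lemmas that follow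
separate the contributions of E, F and R. -/
lemma apply_cliffordAction (v : V) (x : S) :
    B (cliffordAction v x) = σ • cliffordAction v (B x) := by
  simpa using LinearMap.congr_fun (hB v) x

lemma apply_interior (e : E) (x : S) : B (interior e x) = σ • interior e (B x) := by
  have h := apply_cliffordAction hB ![e 0, e 1, e 2, 0, 0, 0, 0] x
  have he : projE ![e 0, e 1, e 2, 0, 0, 0, 0] = e := by
    funext i
    fin_cases i <;> rfl
  simp only [cliffordAction_apply, he] at h
  have h2 : (Real.sqrt 2 : ℂ) ≠ 0 := by simp
  simp [smul_comm σ] at h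
  exact smul_right_injective S h2 h

lemma apply_ι_mul (m : Module.Dual ℂ E) (x : S) :
    B (ExteriorAlgebra.ι ℂ m * x) = σ • (ExteriorAlgebra.ι ℂ m * B x) := by
  let v : V := ![0, 0, 0, 0, m (Pi.single 2 1), m (Pi.single 1 1), m (Pi.single 0 1)]
  have h := apply_cliffordAction hB v x
  have he : projE v = 0 := by
    funext i
    fin_cases i <;> rfl
  have hm : v 6 • ε 0 + v 5 • ε 1 + v 4 • ε 2 = ExteriorAlgebra.ι ℂ m := by
    simp only [ε, ← map_smul, ← map_add]
    congr 1
    ext j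
    fin_cases j <;> simp [v, dualE]
  have h3 : v 3 = 0 := rfl
  have h0 : ∀ x, interior 0 x = 0 := fun x => by simp [interior]
  simp only [cliffordAction_apply, he, hm, h0, h3] at h
  have h2 : (Real.sqrt 2 : ℂ) ≠ 0 := by simp
  simp [smul_comm σ] at h
  exact smul_right_injective S h2 h

lemma apply_parity (x : S) : B (parity x) = σ • parity (B x) := by
  have h := apply_cliffordAction hB ![0, 0, 0, 1, 0, 0, 0] x
  have he : projE ![0, 0, 0, 1, 0, 0, 0] = 0 := by
    funext i
    fin_cases i <;> rfl
  have h0 : ∀ x, interior 0 x = 0 := fun x => by simp [interior]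
  simp only [cliffordAction_apply, he, h0] at h
  refine smul_right_injective S Complex.I_ne_zero ?_
  simpa [smul_comm σ] using h

end Schur

/-- An endomorphism that commutes with the Clifford action is a scalar. -/
theorem exists_eq_smul_one_of_commute {B : Module.End ℂ S}
    (hB : ∀ v, B * cliffordAction v = cliffordAction v * B) : ∃ r : ℂ, B = r • 1 := by
  replace hB : ∀ v, B * cliffordAction v = (1 : ℂ) • (cliffordAction v * B) := by simpa using hB
  -- B 1 is again a vacuum vector, and S is generated from 1 by products with one-forms, which B
  -- respects.
  obtain ⟨r, hr⟩ := exists_smul_one_of_interior_eq_zero (y := B 1) fun e => by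
    simpa [interior_one] using (apply_interior hB e 1).symm
  refine ⟨r, LinearMap.ext fun x => ?_⟩
  induction x using CliffordAlgebra.left_induction with
  | algebraMap c =>
    change B (algebraMap ℂ S c) = (r • (1 : Module.End ℂ S)) (algebraMap ℂ S c)
    rw [Algebra.algebraMap_eq_smul_one, map_smul, hr]
    simp [smul_comm c]
  | add x y hx hy => rw [map_add, map_add, hx, hy]
  | ι_mul x m hx =>
    refine (apply_ι_mul hB m x).trans ?_
    rw [hx]
    simp

/-- An endomorphism that anticommutes with the Clifford action vanishes. -/
theorem eq_zero_of_anticommute {B : Module.End ℂ S}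
    (hB : ∀ v, B * cliffordAction v = (-1 : ℂ) • (cliffordAction v * B)) : B = 0 := by
  obtain ⟨r, hr⟩ := exists_smul_one_of_interior_eq_zero (y := B 1) fun e => by
    simpa [interior_one] using (apply_interior hB e 1).symm
  -- Anticommutation with R gives B 1 = -parity (B 1), whereas parity fixes B 1, which is a multiple
  -- of 1.
  have h1 : B 1 = 0 := by
    have h := apply_parity hB 1
    rw [parity_one, hr, map_smul, parity_one] at h
    rw [hr]
    refine (smul_eq_zero.1 (?_ : (2 : ℂ) • r • (1 : S) = 0)).resolve_left two_ne_zero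
    rw [two_smul]
    nth_rewrite 1 [h]
    module
  refine LinearMap.ext fun x => ?_
  induction x using CliffordAlgebra.left_induction with
  | algebraMap c =>
    change B (algebraMap ℂ S c) = 0
    rw [Algebra.algebraMap_eq_smul_one, map_smul, h1, smul_zero]
  | add x y hx hy => rw [map_add, map_add, hx, hy]
  | ι_mul x m hx =>
    refine (apply_ι_mul hB m x).trans ?_
    rw [hx]
    simp

/-! ### Faithfulness -/

lemma cliffordRep_ι (v : V) : cliffordRep (CliffordAlgebra.ι q v) = cliffordAction v := by
  simp [cliffordRep]

lemma spinRep_coe (x : spinGroup q) :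
    ((spinRep x : GLS) : Module.End ℂ S) = cliffordRep (x : CliffordAlgebra q) := rfl

/-- Conjugation by a spin element x maps `V` to itself. If x acts trivially on S, each vector and
its conjugate act alike, hence coincide because `V` acts injectively. So x is even and commutes with
all vectors, hence is a scalar, and this scalar acts as 1. -/
theorem spinRep_injective : Function.Injective spinRep := by
  rw [injective_iff_map_eq_one]
  intro x hx
  have hρ : cliffordRep (x : CliffordAlgebra q) = 1 := by
    rw [← spinRep_coe, hx, Units.val_one]
  have hcomm : ∀ v, CliffordAlgebra.ι q v * (x : CliffordAlgebra q) =
      (x : CliffordAlgebra q) * CliffordAlgebra.ι q v := by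
    intro v
    have hmem := spinGroup.conjAct_smul_ι_mem_range_ι (x := spinGroup.toUnits x) x.2 v
    obtain ⟨w, hw⟩ := hmem
    rw [ConjAct.units_smul_def, ConjAct.ofConjAct_toConjAct, Units.eq_mul_inv_iff_mul_eq] at hw
    have hw' : CliffordAlgebra.ι q w * (x : CliffordAlgebra q) =
      (x : CliffordAlgebra q) * CliffordAlgebra.ι q v := hw
    have h := congrArg cliffordRep hw'
    rw [map_mul, map_mul, hρ, mul_one, one_mul, cliffordRep_ι, cliffordRep_ι] at h
    rwa [cliffordAction_injective h] at hw'
  obtain ⟨r, hr⟩ := CliffordAlgebra.exists_eq_algebraMap_of_commute (Pi.basisFun ℂ (Fin 7))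
    polarBilin_q_surjective (spinGroup.involute_eq x.2) hcomm
  rw [hr, AlgHom.commutes] at hρ
  have h1 : r = 1 := by
    have h := LinearMap.congr_fun hρ (spinBasis (.inl 0))
    rw [Module.algebraMap_end_apply, Module.End.one_apply] at h
    simpa [φ_inl] using congrArg (φ 0) h
  apply Subtype.ext
  rw [hr, h1, map_one]
  rfl

end CayleySpin

/-! ### Top-degree wedge products as determinants. -/

namespace AlternatingMap

variable {R M N : Type*} [CommRing R] [AddCommGroup M] [Module R M] [AddCommGroup N] [Module R N]
  {ι : Type*} [DecidableEq ι] [Fintype ι]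

theorem apply_eq_basis_det_smul (e : Module.Basis ι R M) (f : M [⋀^ι]→ₗ[R] N) (v : ι → M) :
    f v = e.det v • f e := by
  have h : f = (LinearMap.toSpanSingleton R N (f e)).compAlternatingMap e.det := by
    refine e.ext_alternating fun w hw => ?_
    obtain ⟨σ, rfl⟩ : ∃ σ : Equiv.Perm ι, w = σ :=
      ⟨Equiv.ofBijective w (Finite.injective_iff_bijective.1 hw), rfl⟩
    have h1 := f.map_perm e σ
    have h2 := e.det.map_perm e σ
    simp only [Function.comp_def] at h1 h2
    simp [h1, h2, e.det_self]
  conv_lhs => rw [h]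
  simp

end AlternatingMap

namespace ExteriorAlgebra

variable {R M : Type*} [CommRing R] [AddCommGroup M] [Module R M] {m n : ℕ}

/-- The wedge product of `m` vectors with the last `n` vectors of a basis of size `m + n`. -/
theorem ιMulti_mul_ιMulti_basis (b : Module.Basis (Fin (m + n)) R M) (a : Fin m → M) :
    ιMulti R m a * ιMulti R n (fun j => b (Fin.natAdd m j)) =
      (Matrix.of fun i j => b.coord (Fin.castAdd n i) (a j)).det • ιMulti R (m + n) b := by
  rw [ιMulti_mul_ιMulti, AlternatingMap.apply_eq_basis_det_smul b, Module.Basis.det_apply]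
  congr 1
  rw [← Matrix.det_submatrix_equiv_self (finSumFinEquiv (m := m) (n := n))]
  -- The last n columns are basis vectors, so the matrix is block triangular with an identity block.
  have : (b.toMatrix (Fin.append a fun j => b (Fin.natAdd m j))).submatrix finSumFinEquiv
      finSumFinEquiv = Matrix.fromBlocks (Matrix.of fun i j => b.coord (Fin.castAdd n i) (a j)) 0
        (Matrix.of fun i j => b.coord (Fin.natAdd m i) (a j)) 1 := by
    ext i j
    rcases i with i | i <;> rcases j with j | j
    · simp [Module.Basis.toMatrix_apply]
    · simp [Module.Basis.toMatrix_apply, Finsupp.single_apply, Fin.ext_iff]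
      omega
    · simp [Module.Basis.toMatrix_apply]
    · simp [Module.Basis.toMatrix_apply, Finsupp.single_apply, Matrix.one_apply, eq_comm]
  rw [this, Matrix.det_fromBlocks_zero₁₂, Matrix.det_one, mul_one]

end ExteriorAlgebra

/-! ### Hodge duality and the anti-self-duality of the Cayley form. -/

namespace CayleySpin

/-- The basis `(φ⁰, …, φ³, ψ⁰, …, ψ³)` of the dual of `S`, indexed by `Fin 8`. -/
def dualSpinBasis : Module.Basis (Fin (4 + 4)) ℂ (Module.Dual ℂ S) :=
  spinBasis.dualBasis.reindex finSumFinEquiv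

/-- The basis `(φ₀, …, φ₃, ψ₀, …, ψ₃)` of `S`, indexed by `Fin 8`. -/
def spinBasis₈ : Module.Basis (Fin (4 + 4)) ℂ S := spinBasis.reindex finSumFinEquiv

lemma dualSpinBasis_coe : ⇑dualSpinBasis = ![φ 0, φ 1, φ 2, φ 3, ψ 0, ψ 1, ψ 2, ψ 3] := by
  funext i
  have h : ∀ k, dualSpinBasis (finSumFinEquiv k) = spinBasis.coord k := fun k => by
    simp [dualSpinBasis]
  fin_cases i
  exacts [h (.inl 0), h (.inl 1), h (.inl 2), h (.inl 3), h (.inr 0), h (.inr 1), h (.inr 2),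
    h (.inr 3)]

lemma spinBasis₈_coe : ⇑spinBasis₈ = ![spinBasis (.inl 0), spinBasis (.inl 1), spinBasis (.inl 2),
    spinBasis (.inl 3), spinBasis (.inr 0), spinBasis (.inr 1), spinBasis (.inr 2),
    spinBasis (.inr 3)] := by
  funext i
  have h : ∀ k, spinBasis₈ (finSumFinEquiv k) = spinBasis k := fun k => by
    simp [spinBasis₈]
  fin_cases i
  exacts [h (.inl 0), h (.inl 1), h (.inl 2), h (.inl 3), h (.inr 0), h (.inr 1), h (.inr 2),
    h (.inr 3)]

lemma dualSpinBasis_coord (i : Fin (4 + 4)) (a : Module.Dual ℂ S) :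
    dualSpinBasis.coord i a = a (spinBasis₈ i) := by
  simp [dualSpinBasis, spinBasis₈]

lemma sharp_eq {a : Module.Dual ℂ S} {s : S} (h : ∀ t, η s t = a t) : sharp a = s := by
  rw [sharp, LinearEquiv.coe_coe, LinearEquiv.symm_apply_eq]
  exact LinearMap.ext fun t => (h t).symm

lemma sharp_φ (i : Fin 4) : sharp (φ i) = spinBasis (.inr i) := sharp_eq (η_inr i)

lemma sharp_ψ (i : Fin 4) : sharp (ψ i) = spinBasis (.inl i) := sharp_eq (η_inl i)

lemma η₄_add (α β γ : FourForms) : η₄ α (β + γ) = η₄ α β + η₄ α γ := by simp [η₄]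

lemma η₄_smul (c : ℂ) (α β : FourForms) : η₄ α (c • β) = c * η₄ α β := by simp [η₄]

/-- Hodge duality may be tested on decomposable forms. -/
lemma isHodgeDual_of_ιMulti {β β' : FourForms}
    (h : ∀ a : Fin 4 → Module.Dual ℂ S, ExteriorAlgebra.ιMulti ℂ 4 a * β' =
      η₄ (exteriorPower.ιMulti ℂ 4 a) β • vol) : IsHodgeDual β β' := by
  have : (LinearMap.mulRight ℂ (β' : ExteriorAlgebra ℂ (Module.Dual ℂ S))) ∘ₗ
      (⋀[ℂ]^4 (Module.Dual ℂ S)).subtype = LinearMap.toSpanSingleton ℂ _ vol ∘ₗ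
        (exteriorPower.pairingDual ℂ S 4).flip (exteriorPower.map 4 sharp β) := by
    refine exteriorPower.linearMap_ext (AlternatingMap.ext fun a => ?_)
    exact h a
  exact fun α => LinearMap.congr_fun this α

lemma IsHodgeDual.add {β β' γ γ' : FourForms} (h : IsHodgeDual β β') (k : IsHodgeDual γ γ') :
    IsHodgeDual (β + γ) (β' + γ') := fun α => by
  rw [Submodule.coe_add, mul_add, h, k, η₄_add, add_smul]

lemma IsHodgeDual.smul {β β' : FourForms} (h : IsHodgeDual β β') (c : ℂ) :
    IsHodgeDual (c • β) (c • β') := fun α => by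
  rw [Submodule.coe_smul, mul_smul_comm, h, η₄_smul, mul_smul]

/-- The Hodge dual of a wedge product of basis elements: complementing the metric duals. -/
lemma isHodgeDual_wedge₄ (σ : Equiv.Perm (Fin (4 + 4))) (c : Fin 4 → Module.Dual ℂ S)
    (hc : ∀ j, sharp (c j) = spinBasis₈ (σ (Fin.castAdd 4 j))) :
    IsHodgeDual (exteriorPower.ιMulti ℂ 4 c) ((σ.sign : ℂ) •
      exteriorPower.ιMulti ℂ 4 fun j => dualSpinBasis (σ (Fin.natAdd 4 j))) := by
  refine isHodgeDual_of_ιMulti fun a => ?_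
  -- Relabelled by σ, the complementary covectors become the last four of the basis. The sign of σ
  -- occurs once in the reordering to `vol` and once in the proposed dual, so it cancels.
  have hb := ExteriorAlgebra.ιMulti_mul_ιMulti_basis (dualSpinBasis.reindex σ.symm) a
  have hcoe : ⇑(dualSpinBasis.reindex σ.symm) = dualSpinBasis ∘ σ := by
    funext i
    simp
  have hvol : ExteriorAlgebra.ιMulti ℂ (4 + 4) dualSpinBasis = vol := by
    rw [dualSpinBasis_coe]; rfl
  rw [hcoe, AlternatingMap.map_perm, hvol] at hb
  rw [Submodule.coe_smul, mul_smul_comm, exteriorPower.ιMulti_apply_coe]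
  refine (congrArg _ hb).trans ?_
  rw [η₄, exteriorPower.map_apply_ιMulti, exteriorPower.pairingDual_ιMulti_ιMulti, smul_smul,
    Units.smul_def, ← Int.cast_smul_eq_zsmul ℂ, smul_smul, mul_right_comm, ← Int.cast_mul,
    ← Units.val_mul, Int.units_mul_self, Units.val_one, Int.cast_one, one_mul]
  congr 2
  ext i j
  simp only [Matrix.of_apply, Function.comp_apply, hc]
  rw [← dualSpinBasis_coord]
  simp

lemma isHodgeDual_wedge₄_of_eq (σ : Equiv.Perm (Fin (4 + 4))) (s : ℤˣ) (hs : σ.sign = s)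
    {a b c d a' b' c' d' : Module.Dual ℂ S}
    (hc : ∀ j, sharp (![a, b, c, d] j) = spinBasis₈ (σ (Fin.castAdd 4 j)))
    (hd : ∀ j, ![a', b', c', d'] j = dualSpinBasis (σ (Fin.natAdd 4 j))) :
    IsHodgeDual (wedge₄ a b c d) ((s : ℂ) • wedge₄ a' b' c' d') := by
  have h := isHodgeDual_wedge₄ σ ![a, b, c, d] hc
  rw [← funext hd, hs] at h
  exact h

theorem isAntiSelfDual_Q : IsAntiSelfDual Q := by
  -- In each permutation the first four entries index the metric duals of the factors, where `sharp`
  -- exchanges i and i + 4, and the last four are the complement in increasing order; the second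
  -- list is the inverse. The first six monomials are exchanged in pairs with sign +1, and the two
  -- members of a pair have opposite signs in Q. The last two are their own duals up to -1.
  have h1 : IsHodgeDual (wedge₄ (φ 0) (φ 1) (ψ 0) (ψ 1))
      (((1 : ℤˣ) : ℂ) • wedge₄ (φ 2) (φ 3) (ψ 2) (ψ 3)) :=
    isHodgeDual_wedge₄_of_eq ⟨![4, 5, 0, 1, 2, 3, 6, 7], ![2, 3, 4, 5, 0, 1, 6, 7], by decide, by decide⟩ _
      (by decide) (fun j => by fin_cases j <;> simp [sharp_φ, sharp_ψ, spinBasis₈_coe])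
      (fun j => by fin_cases j <;> simp [dualSpinBasis_coe])
  have h2 : IsHodgeDual (wedge₄ (φ 0) (φ 2) (ψ 0) (ψ 2))
      (((1 : ℤˣ) : ℂ) • wedge₄ (φ 1) (φ 3) (ψ 1) (ψ 3)) :=
    isHodgeDual_wedge₄_of_eq ⟨![4, 6, 0, 2, 1, 3, 5, 7], ![2, 4, 3, 5, 0, 6, 1, 7], by decide, by decide⟩ _
      (by decide) (fun j => by fin_cases j <;> simp [sharp_φ, sharp_ψ, spinBasis₈_coe])
      (fun j => by fin_cases j <;> simp [dualSpinBasis_coe])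
  have h3 : IsHodgeDual (wedge₄ (φ 0) (φ 3) (ψ 0) (ψ 3))
      (((1 : ℤˣ) : ℂ) • wedge₄ (φ 1) (φ 2) (ψ 1) (ψ 2)) :=
    isHodgeDual_wedge₄_of_eq ⟨![4, 7, 0, 3, 1, 2, 5, 6], ![2, 4, 5, 3, 0, 6, 7, 1], by decide, by decide⟩ _
      (by decide) (fun j => by fin_cases j <;> simp [sharp_φ, sharp_ψ, spinBasis₈_coe])
      (fun j => by fin_cases j <;> simp [dualSpinBasis_coe])
  have h4 : IsHodgeDual (wedge₄ (φ 1) (φ 2) (ψ 1) (ψ 2))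
      (((1 : ℤˣ) : ℂ) • wedge₄ (φ 0) (φ 3) (ψ 0) (ψ 3)) :=
    isHodgeDual_wedge₄_of_eq ⟨![5, 6, 1, 2, 0, 3, 4, 7], ![4, 2, 3, 5, 6, 0, 1, 7], by decide, by decide⟩ _
      (by decide) (fun j => by fin_cases j <;> simp [sharp_φ, sharp_ψ, spinBasis₈_coe])
      (fun j => by fin_cases j <;> simp [dualSpinBasis_coe])
  have h5 : IsHodgeDual (wedge₄ (φ 1) (φ 3) (ψ 1) (ψ 3))
      (((1 : ℤˣ) : ℂ) • wedge₄ (φ 0) (φ 2) (ψ 0) (ψ 2)) :=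
    isHodgeDual_wedge₄_of_eq ⟨![5, 7, 1, 3, 0, 2, 4, 6], ![4, 2, 5, 3, 6, 0, 7, 1], by decide, by decide⟩ _
      (by decide) (fun j => by fin_cases j <;> simp [sharp_φ, sharp_ψ, spinBasis₈_coe])
      (fun j => by fin_cases j <;> simp [dualSpinBasis_coe])
  have h6 : IsHodgeDual (wedge₄ (φ 2) (φ 3) (ψ 2) (ψ 3))
      (((1 : ℤˣ) : ℂ) • wedge₄ (φ 0) (φ 1) (ψ 0) (ψ 1)) :=
    isHodgeDual_wedge₄_of_eq ⟨![6, 7, 2, 3, 0, 1, 4, 5], ![4, 5, 2, 3, 6, 7, 0, 1], by decide, by decide⟩ _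
      (by decide) (fun j => by fin_cases j <;> simp [sharp_φ, sharp_ψ, spinBasis₈_coe])
      (fun j => by fin_cases j <;> simp [dualSpinBasis_coe])
  have h7 : IsHodgeDual (wedge₄ (φ 0) (ψ 1) (ψ 2) (ψ 3))
      (((-1 : ℤˣ) : ℂ) • wedge₄ (φ 0) (ψ 1) (ψ 2) (ψ 3)) :=
    isHodgeDual_wedge₄_of_eq ⟨![4, 1, 2, 3, 0, 5, 6, 7], ![4, 1, 2, 3, 0, 5, 6, 7], by decide, by decide⟩ _
      (by decide) (fun j => by fin_cases j <;> simp [sharp_φ, sharp_ψ, spinBasis₈_coe])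
      (fun j => by fin_cases j <;> simp [dualSpinBasis_coe])
  have h8 : IsHodgeDual (wedge₄ (φ 1) (φ 2) (φ 3) (ψ 0))
      (((-1 : ℤˣ) : ℂ) • wedge₄ (φ 1) (φ 2) (φ 3) (ψ 0)) :=
    isHodgeDual_wedge₄_of_eq ⟨![5, 6, 7, 0, 1, 2, 3, 4], ![3, 4, 5, 6, 7, 0, 1, 2], by decide, by decide⟩ _
      (by decide) (fun j => by fin_cases j <;> simp [sharp_φ, sharp_ψ, spinBasis₈_coe])
      (fun j => by fin_cases j <;> simp [dualSpinBasis_coe])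
  have h := (((((((h1.add h2).add h3).add (h4.smul (-1))).add (h5.smul (-1))).add
    (h6.smul (-1))).add (h7.smul (-2))).add (h8.smul 2))
  unfold IsAntiSelfDual
  convert h using 1
  · rw [Q]
    module
  · rw [Q]
    push_cast
    module

end CayleySpin

namespace exteriorPower

variable {R M N : Type*} [CommRing R] [AddCommGroup M] [Module R M] [AddCommGroup N] [Module R N]

/-- This allows the pullback of Q to be computed in the exterior algebra, where it is
multiplicative. -/
lemma coe_map {n : ℕ} (f : M →ₗ[R] N) (x : ⋀[R]^n M) :
    (map n f x : ExteriorAlgebra R N) = ExteriorAlgebra.map f x := by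
  have : (⋀[R]^n N).subtype ∘ₗ map n f = (ExteriorAlgebra.map f).toLinearMap ∘ₗ
      (⋀[R]^n M).subtype := by
    refine linearMap_ext (AlternatingMap.ext fun a => ?_)
    simp
  exact LinearMap.congr_fun this x

end exteriorPower

namespace CayleySpin

/-! ### Stabilizers of conformal classes -/

lemma mem_stabilizer_conformalClass {W : Type*} [AddCommGroup W] [Module ℂ W]
    (r : Representation ℂ GLS W) (w : W) (A : GLS) :
    A ∈ stabilizer r (conformalClass w) ↔ ∃ c : ℂˣ, r A w = (c : ℂ) • w := by
  constructor
  · intro h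
    have : r A w ∈ conformalClass w := by
      rw [← show r A '' conformalClass w = conformalClass w from h]
      exact ⟨w, ⟨1, by simp⟩, rfl⟩
    exact this
  · rintro ⟨c, hc⟩
    change r A '' conformalClass w = conformalClass w
    ext x
    constructor
    · rintro ⟨_, ⟨d, rfl⟩, rfl⟩
      exact ⟨d * c, by rw [map_smul, hc, smul_smul, Units.val_mul]⟩
    · rintro ⟨d, rfl⟩
      refine ⟨_, ⟨d * c⁻¹, rfl⟩, ?_⟩
      rw [map_smul, hc, smul_smul, ← Units.val_mul, inv_mul_cancel_right]

lemma inv_apply_apply (A : GLS) (s : S) :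
    ((A⁻¹ : GLS) : Module.End ℂ S) ((A : Module.End ℂ S) s) = s := by
  rw [← Module.End.mul_apply, ← Units.val_mul, inv_mul_cancel, Units.val_one, Module.End.one_apply]

lemma apply_inv_apply (A : GLS) (s : S) :
    (A : Module.End ℂ S) (((A⁻¹ : GLS) : Module.End ℂ S) s) = s := by
  simpa using inv_apply_apply A⁻¹ s

/-- Membership is tested on A⁻¹, so that the action becomes the pullback along A itself. -/
lemma mem_CO_iff (A : GLS) : A ∈ CO ↔
    ∃ c : ℂˣ, ∀ s t, η ((A : Module.End ℂ S) s) ((A : Module.End ℂ S) t) = c * η s t := by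
  rw [← inv_mem_iff, CO, mem_stabilizer_conformalClass]
  refine exists_congr fun c => ?_
  have h : actBilin A⁻¹ η = η.comp (A : Module.End ℂ S) (A : Module.End ℂ S) := by
    conv_rhs => rw [← inv_inv A]
    rfl
  rw [h]
  constructor
  · intro h s t
    exact LinearMap.congr_fun (LinearMap.congr_fun h s) t
  · intro h
    exact LinearMap.ext fun s => LinearMap.ext fun t => h s t

lemma mem_stabilizer_Q_iff (A : GLS) : A ∈ stabilizer actFour (conformalClass Q) ↔
    ∃ c : ℂˣ, exteriorPower.map 4 (LinearMap.dualMap (A : Module.End ℂ S)) Q = (c : ℂ) • Q := by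
  rw [← inv_mem_iff, mem_stabilizer_conformalClass]
  have h : actFour A⁻¹ Q = exteriorPower.map 4 (LinearMap.dualMap (A : Module.End ℂ S)) Q := by
    conv_rhs => rw [← inv_inv A]
    rfl
  rw [h]

/-- Multiplication by a non-zero scalar, as an element of `GL(S)`. -/
def homothety : ℂˣ →* GLS := Units.map (algebraMap ℂ (Module.End ℂ S)).toMonoidHom

lemma homothety_apply (c : ℂˣ) (s : S) : (homothety c : Module.End ℂ S) s = (c : ℂ) • s := rfl

lemma coe_homothety_mul (c : ℂˣ) (A : GLS) :
    ((homothety c * A : GLS) : Module.End ℂ S) = (c : ℂ) • (A : Module.End ℂ S) := by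
  refine LinearMap.ext fun s => ?_
  rw [Units.val_mul, Module.End.mul_apply, homothety_apply, LinearMap.smul_apply]

lemma mem_scalarMul_iff (H : Subgroup GLS) (A : GLS) :
    A ∈ scalarMul H ↔ ∃ c : ℂˣ, homothety c * A ∈ H := by
  constructor
  · rintro ⟨c, h, hh, hA⟩
    refine ⟨c⁻¹, ?_⟩
    convert hh
    apply Units.ext
    rw [coe_homothety_mul, hA, smul_smul, ← Units.val_mul, inv_mul_cancel, Units.val_one, one_smul]
  · rintro ⟨c, h⟩
    refine ⟨c⁻¹, _, h, ?_⟩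
    rw [coe_homothety_mul, smul_smul, ← Units.val_mul, inv_mul_cancel, Units.val_one, one_smul]

lemma homothety_mem_CO (c : ℂˣ) : homothety c ∈ CO := by
  rw [mem_CO_iff]
  refine ⟨c * c, fun s t => ?_⟩
  simp [homothety_apply, mul_assoc]

theorem CO_eq : CO = scalarMul O := by
  ext A
  rw [mem_scalarMul_iff]
  constructor
  · intro hA
    obtain ⟨c, hc⟩ := (mem_CO_iff A).1 hA
    -- If A scales η by c and d² = 1/c, then dA is an isometry.
    obtain ⟨d, hd⟩ := IsAlgClosed.exists_eq_mul_self ((c : ℂ)⁻¹)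
    have hd0 : d ≠ 0 := by
      rintro rfl
      simp at hd
    refine ⟨Units.mk0 d hd0, fun s t => ?_⟩
    rw [coe_homothety_mul]
    simp only [LinearMap.smul_apply, map_smul, Units.val_mk0, smul_eq_mul, hc]
    rw [← mul_assoc, ← mul_assoc, ← hd, inv_mul_cancel₀ c.ne_zero, one_mul]
  · rintro ⟨c, hc⟩
    refine (Subgroup.mul_mem_cancel_left _ (homothety_mem_CO c)).1 ((mem_CO_iff _).2 ⟨1, ?_⟩)
    intro s t
    rw [hc, Units.val_one, one_mul]

/-! ### The Cayley form as a Casimir element -/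

/-- The projection of bilinear forms to two-forms. -/
def toTwoForm : LinearMap.BilinForm ℂ S →ₗ[ℂ] ExteriorAlgebra ℂ (Module.Dual ℂ S) where
  toFun β := ∑ k, ExteriorAlgebra.ι ℂ (spinBasis.coord k) * ExteriorAlgebra.ι ℂ (β (spinBasis k))
  map_add' β γ := by simp [mul_add, Finset.sum_add_distrib]
  map_smul' c β := by simp [Finset.smul_sum]

lemma toTwoForm_apply (β : LinearMap.BilinForm ℂ S) : toTwoForm β =
    ∑ k, ExteriorAlgebra.ι ℂ (spinBasis.coord k) * ExteriorAlgebra.ι ℂ (β (spinBasis k)) := rfl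

lemma dual_eq_sum (a : Module.Dual ℂ S) : a = ∑ k, a (spinBasis k) • spinBasis.coord k :=
  (spinBasis.sum_dual_apply_smul_coord a).symm

lemma toTwoForm_linMulLin (a b : Module.Dual ℂ S) :
    toTwoForm (LinearMap.BilinForm.linMulLin a b) =
      ExteriorAlgebra.ι ℂ a * ExteriorAlgebra.ι ℂ b := by
  conv_rhs => rw [dual_eq_sum a, map_sum, Finset.sum_mul]
  rw [toTwoForm_apply]
  refine Finset.sum_congr rfl fun k _ => ?_
  have : LinearMap.BilinForm.linMulLin a b (spinBasis k) = a (spinBasis k) • b :=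
    LinearMap.ext fun t => by simp [LinearMap.BilinForm.linMulLin_apply]
  rw [this, map_smul, map_smul, mul_smul_comm, smul_mul_assoc]

/-- `toTwoForm` does not divide by 2, so a skew form is doubled; two such factors account for 4 of
the 24 in `casimir_eq`. -/
lemma toTwoForm_wedge₂ (a b : Module.Dual ℂ S) :
    toTwoForm (wedge₂ a b) = (2 : ℂ) • (ExteriorAlgebra.ι ℂ a * ExteriorAlgebra.ι ℂ b) := by
  rw [wedge₂, map_sub, toTwoForm_linMulLin, toTwoForm_linMulLin,
    eq_neg_of_add_eq_zero_left (ExteriorAlgebra.ι_add_mul_swap b a)]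
  module

lemma map_toTwoForm (T : Module.End ℂ S) (β : LinearMap.BilinForm ℂ S) :
    ExteriorAlgebra.map T.dualMap (toTwoForm β) = toTwoForm (β.comp T T) := by
  have h : β.comp T T = ∑ k, LinearMap.BilinForm.linMulLin (spinBasis.coord k ∘ₗ T)
      (β (spinBasis k) ∘ₗ T) := by
    refine LinearMap.ext fun s => LinearMap.ext fun t => ?_
    simp only [LinearMap.BilinForm.comp_apply, LinearMap.sum_apply,
      LinearMap.BilinForm.linMulLin_apply, LinearMap.comp_apply]
    conv_lhs => rw [← spinBasis.sum_repr (T s)]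
    simp only [map_sum, map_smul, LinearMap.sum_apply, LinearMap.smul_apply, smul_eq_mul,
      Module.Basis.coord_apply]
  rw [h, map_sum]
  simp only [toTwoForm_linMulLin]
  simp [toTwoForm]
  rfl

/-- The image of a vector under `V → Λ² S^*`. -/
def vecForm : V →ₗ[ℂ] ExteriorAlgebra ℂ (Module.Dual ℂ S) := toTwoForm ∘ₗ twoForm

/-- The Casimir element of `V → Λ² S^*`. -/
def casimir : ExteriorAlgebra ℂ (Module.Dual ℂ S) :=
  ∑ i : Fin 7, vecForm (Pi.single i 1) * vecForm (Pi.single i.rev 1)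

/-- The Clifford relation gives uvu = B(u,v)u - q(u)v for the polar form B, and moving u across η
changes the sign. -/
lemma twoForm_comp (u v : V) : (twoForm v).comp (cliffordAction u) (cliffordAction u) =
    twoForm (q u • v - QuadraticMap.polarBilin q u v • u) := by
  refine LinearMap.ext fun s => LinearMap.ext fun t => ?_
  have h1 : cliffordAction u (cliffordAction u s) = q u • s :=
    LinearMap.congr_fun (cliffordAction_sq u) s
  have h2 := LinearMap.congr_fun (cliffordAction_mul_add u v) (cliffordAction u s)
  simp only [LinearMap.add_apply, Module.End.mul_apply, LinearMap.smul_apply,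
    Module.End.one_apply, h1] at h2
  rw [LinearMap.BilinForm.comp_apply, twoForm_apply, twoForm_apply, ← neg_inj,
    ← η_cliffordAction, eq_sub_of_add_eq h2]
  simp

lemma map_vecForm (u v : V) : ExteriorAlgebra.map (cliffordAction u).dualMap (vecForm v) =
    vecForm (q u • v - QuadraticMap.polarBilin q u v • u) := by
  rw [vecForm, LinearMap.comp_apply, map_toTwoForm, twoForm_comp]
  rfl

/-- For q(u) ≠ 0 this is the invariance of the Casimir element under the reflection in u, scaled by
q(u) in both factors. The direct expansion needs no assumption on q(u): the multiples of the square
of `vecForm u` have coefficients 2q(u), 2q(u) and -4q(u), which cancel. -/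
lemma map_casimir (u : V) :
    ExteriorAlgebra.map (cliffordAction u).dualMap casimir = (q u * q u) • casimir := by
  have hp : ∀ i : Fin 7, QuadraticMap.polarBilin q u (Pi.single i 1) = -2 * u i.rev := fun i => by
    simpa using polarBilin_q_single u i.rev
  have hu : vecForm u = ∑ i : Fin 7, u i • vecForm (Pi.single i 1) := by
    conv_lhs => rw [pi_eq_sum_univ' u]
    simp only [map_sum, map_smul]
  have hq : ∑ i : Fin 7, u i * u i.rev = -q u := by
    have := polarBilin_q u u
    rw [CliffordAlgebra.polarBilin_self] at this
    linear_combination (1 / 2) * this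
  have hu' : vecForm u = ∑ i : Fin 7, u i.rev • vecForm (Pi.single i.rev 1) := by
    rw [hu]
    exact (Equiv.sum_comp Fin.revPerm fun i => u i • vecForm (Pi.single i 1)).symm
  simp only [casimir, map_sum, map_mul, map_vecForm, hp, Fin.rev_rev, map_sub, map_smul]
  have key : ∀ i : Fin 7, (q u • vecForm (Pi.single i 1) - (-2 * u i.rev) • vecForm u) *
      (q u • vecForm (Pi.single i.rev 1) - (-2 * u i) • vecForm u) =
      (q u * q u) • (vecForm (Pi.single i 1) * vecForm (Pi.single i.rev 1))
      + (2 * q u) • ((u i • vecForm (Pi.single i 1)) * vecForm u)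
      + (2 * q u) • (vecForm u * (u i.rev • vecForm (Pi.single i.rev 1)))
      + (4 : ℂ) • ((u i * u i.rev) • (vecForm u * vecForm u)) := by
    intro i
    simp only [sub_mul, mul_sub, smul_mul_assoc, mul_smul_comm]
    module
  simp only [key, Finset.sum_add_distrib, ← Finset.smul_sum, ← Finset.sum_mul, ← Finset.mul_sum,
    ← hu, ← hu', ← Finset.sum_smul, hq]
  module

lemma vecForm_eq (v : V) : vecForm v =
    (Real.sqrt 2 : ℂ) • (
      v 6 • (toTwoForm (wedge₂ (φ 0) (ψ 1))
        + toTwoForm (wedge₂ (φ 2) (φ 3)))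
      + v 5 • (toTwoForm (wedge₂ (φ 0) (ψ 2))
        + toTwoForm (wedge₂ (φ 3) (φ 1)))
      + v 4 • (toTwoForm (wedge₂ (φ 0) (ψ 3))
        + toTwoForm (wedge₂ (φ 1) (φ 2)))
      - v 0 • (toTwoForm (wedge₂ (φ 1) (ψ 0))
        - toTwoForm (wedge₂ (ψ 2) (ψ 3)))
      - v 1 • (toTwoForm (wedge₂ (φ 2) (ψ 0))
        - toTwoForm (wedge₂ (ψ 3) (ψ 1)))
      - v 2 • (toTwoForm (wedge₂ (φ 3) (ψ 0))
        - toTwoForm (wedge₂ (ψ 1) (ψ 2))))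
    + (v 3 * Complex.I) • (toTwoForm (wedge₂ (φ 0) (ψ 0))
        - toTwoForm (wedge₂ (φ 1) (ψ 1))
        - toTwoForm (wedge₂ (φ 2) (ψ 2))
        - toTwoForm (wedge₂ (φ 3) (ψ 3))) := by
  refine (congrArg toTwoForm (twoForm_eq v)).trans ?_
  simp only [map_add, map_sub, map_smul]

lemma coe_wedge₄ (a b c d : Module.Dual ℂ S) :
    (wedge₄ a b c d : ExteriorAlgebra ℂ (Module.Dual ℂ S)) =
      ExteriorAlgebra.ι ℂ a * (ExteriorAlgebra.ι ℂ b * (ExteriorAlgebra.ι ℂ c *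
        ExteriorAlgebra.ι ℂ d)) := by
  simp [wedge₄, ExteriorAlgebra.ιMulti_apply]

-- The factor is 4·(-6): 4 from `toTwoForm`, and -6 from the normalization of the Clifford action.
-- For the first monomial of Q, the square of the R-term contributes -2 and the pairing of e₁ with
-- f₁ contributes -4.
set_option maxHeartbeats 2000000 in
lemma casimir_eq : casimir = (-24 : ℂ) • (Q : ExteriorAlgebra ℂ (Module.Dual ℂ S)) := by
  have hrev : ∀ i : Fin 7, i.rev = ![6, 5, 4, 3, 2, 1, 0] i := by decide
  obtain ⟨x, hx⟩ : ∃ x : Fin 8 → ExteriorAlgebra ℂ (Module.Dual ℂ S),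
      x = ![.ι ℂ (φ 0), .ι ℂ (φ 1), .ι ℂ (φ 2), .ι ℂ (φ 3), .ι ℂ (ψ 0), .ι ℂ (ψ 1), .ι ℂ (ψ 2),
        .ι ℂ (ψ 3)] := ⟨_, rfl⟩
  have hι : ∃ a : Fin 8 → Module.Dual ℂ S, ∀ i, x i = ExteriorAlgebra.ι ℂ (a i) :=
    ⟨![φ 0, φ 1, φ 2, φ 3, ψ 0, ψ 1, ψ 2, ψ 3], fun i => by rw [hx]; fin_cases i <;> rfl⟩
  obtain ⟨a, ha⟩ := hι
  -- These rules sort every monomial into increasing order; the condition j < i keeps the rewriting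
  -- terminating.
  have hs : ∀ i, x i * x i = 0 := fun i => by rw [ha, ExteriorAlgebra.ι_sq_zero]
  have hs' : ∀ i y, x i * (x i * y) = 0 := fun i y => by rw [← mul_assoc, hs, zero_mul]
  have hw : ∀ i j, j < i → x i * x j = -(x j * x i) := fun i j _ => by
    rw [ha, ha, eq_neg_of_add_eq_zero_left (ExteriorAlgebra.ι_add_mul_swap _ _)]
  have hw' : ∀ i j y, j < i → x i * (x j * y) = -(x j * (x i * y)) := fun i j y h => by
    rw [← mul_assoc, hw i j h, neg_mul, mul_assoc]
  have e0 : ExteriorAlgebra.ι ℂ (φ 0) = x 0 := by rw [hx]; rfl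
  have e1 : ExteriorAlgebra.ι ℂ (φ 1) = x 1 := by rw [hx]; rfl
  have e2 : ExteriorAlgebra.ι ℂ (φ 2) = x 2 := by rw [hx]; rfl
  have e3 : ExteriorAlgebra.ι ℂ (φ 3) = x 3 := by rw [hx]; rfl
  have e4 : ExteriorAlgebra.ι ℂ (ψ 0) = x 4 := by rw [hx]; rfl
  have e5 : ExteriorAlgebra.ι ℂ (ψ 1) = x 5 := by rw [hx]; rfl
  have e6 : ExteriorAlgebra.ι ℂ (ψ 2) = x 6 := by rw [hx]; rfl
  have e7 : ExteriorAlgebra.ι ℂ (ψ 3) = x 7 := by rw [hx]; rfl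
  have h2 : (Real.sqrt 2 : ℂ) * (Real.sqrt 2 : ℂ) = 2 := by
    rw [← Complex.ofReal_mul, Real.mul_self_sqrt (by norm_num)]; norm_num
  simp only [casimir, Fin.sum_univ_seven, hrev, vecForm_eq, toTwoForm_wedge₂, Q, Submodule.coe_add,
    Submodule.coe_sub, Submodule.coe_smul, coe_wedge₄, e0, e1, e2, e3, e4, e5, e6, e7]
  clear e0 e1 e2 e3 e4 e5 e6 e7 ha hx
  have hI : Complex.I ^ 2 = -1 := Complex.I_sq
  rw [← sq] at h2
  generalize (Real.sqrt 2 : ℂ) = r at h2 ⊢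
  generalize Complex.I = i at hI ⊢
  simp [mul_add, add_mul, mul_sub, sub_mul, smul_smul, mul_assoc, hs, hw, hw']
  match_scalars <;> ring_nf <;> simp only [h2, hI] <;> ring

/-! ### `CSpin(7)` stabilizes `[η]` and `[Q]` -/

lemma coe_Q : (Q : ExteriorAlgebra ℂ (Module.Dual ℂ S)) = (-(1 / 24) : ℂ) • casimir := by
  rw [casimir_eq, smul_smul]
  norm_num

lemma map_cliffordAction_Q (u : V) :
    exteriorPower.map 4 (cliffordAction u).dualMap Q = (q u * q u) • Q := by
  apply Subtype.ext
  rw [exteriorPower.coe_map, Submodule.coe_smul, coe_Q, map_smul, map_casimir, smul_comm]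

lemma η_cliffordAction_cliffordAction (u : V) (s t : S) :
    η (cliffordAction u s) (cliffordAction u t) = -q u * η s t := by
  have h : cliffordAction u (cliffordAction u s) = q u • s :=
    LinearMap.congr_fun (cliffordAction_sq u) s
  rw [← neg_inj, ← η_cliffordAction, h]
  simp

lemma homothety_mem_stabCayley (c : ℂˣ) : homothety c ∈ stabCayley := by
  refine ⟨homothety_mem_CO c, (mem_stabilizer_Q_iff _).2 ⟨c ^ 4, ?_⟩⟩
  have h : exteriorPower.map 4 (LinearMap.dualMap (homothety c : Module.End ℂ S)) =
      ((c ^ 4 : ℂˣ) : ℂ) • (LinearMap.id : FourForms →ₗ[ℂ] FourForms) := by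
    refine exteriorPower.linearMap_ext (AlternatingMap.ext fun a => ?_)
    have : ∀ b : Module.Dual ℂ S, LinearMap.dualMap (homothety c : Module.End ℂ S) b =
        (c : ℂ) • b := fun b => LinearMap.ext fun s => by
      rw [LinearMap.dualMap_apply, homothety_apply, map_smul, LinearMap.smul_apply]
    have h2 := (exteriorPower.ιMulti ℂ 4 (M := Module.Dual ℂ S)).map_smul_univ
      (fun _ => (c : ℂ)) a
    simp only [Finset.prod_const, Finset.card_univ, Fintype.card_fin] at h2
    simp only [LinearMap.compAlternatingMap_apply, exteriorPower.map_apply_ιMulti,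
      Function.comp_def, this, h2, LinearMap.smul_apply, LinearMap.id_apply, Units.val_pow_eq_pow_val]
  rw [h, LinearMap.smul_apply, LinearMap.id_apply]

/-- The Lipschitz group is generated by invertible vectors, and a vector v multiplies η by -q(v) and
Q by q(v)². Odd elements are covered too. -/
lemma map_mem_stabCayley {x : (CliffordAlgebra q)ˣ} (hx : x ∈ lipschitzGroup q) :
    Units.map (cliffordRep.toRingHom.toMonoidHom) x ∈ stabCayley := by
  have h : lipschitzGroup q ≤
      stabCayley.comap (Units.map (cliffordRep.toRingHom.toMonoidHom)) := by
    rw [lipschitzGroup, Subgroup.closure_le]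
    rintro y ⟨v, hv⟩
    have hq : q v ≠ 0 := by
      intro h0
      have h1 : (y : CliffordAlgebra q) * y = 0 := by
        rw [← hv, CliffordAlgebra.ι_sq_scalar, h0, map_zero]
      have h2 := y.isUnit.mul_right_eq_zero.1 h1
      exact y.ne_zero h2
    have hA : ((Units.map (cliffordRep.toRingHom.toMonoidHom) y : GLS) : Module.End ℂ S) =
        cliffordAction v := by
      rw [← cliffordRep_ι, hv]
      rfl
    refine ⟨(mem_CO_iff _).2 ⟨Units.mk0 (-q v) (neg_ne_zero.2 hq), fun s t => ?_⟩,
      (mem_stabilizer_Q_iff _).2 ⟨Units.mk0 (q v * q v) (mul_ne_zero hq hq), ?_⟩⟩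
    · rw [hA, η_cliffordAction_cliffordAction]
      rfl
    · rw [hA, map_cliffordAction_Q]
      rfl
  exact h hx

theorem CSpin7_le_stabCayley : CSpin7 ≤ stabCayley := by
  intro A hA
  obtain ⟨c, x, hx⟩ := (mem_scalarMul_iff _ _).1 hA
  refine (Subgroup.mul_mem_cancel_left _ (homothety_mem_stabCayley c)).1 ?_
  rw [← hx]
  exact map_mem_stabCayley (spinGroup.units_mem_lipschitzGroup x.2)

/-! ### Contraction of two-forms with four-forms -/

/-- The contraction `(ω, X) ↦ (s, t) ↦ ∑ ω(s, t, b_k, b_l) X(b^k, b^l)` of a four-form and a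
bilinear form. -/
def contraction (X : LinearMap.BilinForm ℂ S) (s t : S) : FourForms →ₗ[ℂ] ℂ :=
  ∑ k, ∑ l, X (sharp (spinBasis.coord k)) (sharp (spinBasis.coord l)) •
    (exteriorPower.pairingDual ℂ S 4).flip
      (exteriorPower.ιMulti ℂ 4 ![s, t, spinBasis k, spinBasis l])

lemma sum_sharp (X : LinearMap.BilinForm ℂ S) (a b : Module.Dual ℂ S) :
    ∑ k, ∑ l, X (sharp (spinBasis.coord k)) (sharp (spinBasis.coord l)) *
      (a (spinBasis k) * b (spinBasis l)) = X (sharp a) (sharp b) := by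
  conv_rhs => rw [dual_eq_sum a, dual_eq_sum b]
  simp only [map_sum, map_smul, LinearMap.sum_apply, LinearMap.smul_apply, smul_eq_mul,
    Finset.mul_sum]
  refine Eq.trans Finset.sum_comm ?_
  exact Finset.sum_congr rfl fun k _ => Finset.sum_congr rfl fun l _ => by ring

/-- Laplace expansion of the 4×4 determinant into 2×2 minors; it separates the arguments s, t from
those that are summed over in the contraction. -/
lemma pairingDual_wedge₄ (a b c d : Module.Dual ℂ S) (s t u v : S) :
    exteriorPower.pairingDual ℂ S 4 (wedge₄ a b c d) (exteriorPower.ιMulti ℂ 4 ![s, t, u, v]) =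
      wedge₂ a b s t * wedge₂ c d u v - wedge₂ a c s t * wedge₂ b d u v
      + wedge₂ a d s t * wedge₂ b c u v + wedge₂ b c s t * wedge₂ a d u v
      - wedge₂ b d s t * wedge₂ a c u v + wedge₂ c d s t * wedge₂ a b u v := by
  rw [wedge₄, exteriorPower.pairingDual_ιMulti_ιMulti]
  simp [Matrix.det_succ_row_zero, Fin.sum_univ_succ, Fin.succAbove, wedge₂_apply]
  ring

lemma sum_sharp_wedge₂ {X : LinearMap.BilinForm ℂ S} (hX : ∀ s t, X t s = -X s t)
    (a b : Module.Dual ℂ S) :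
    ∑ k, ∑ l, X (sharp (spinBasis.coord k)) (sharp (spinBasis.coord l)) *
      wedge₂ a b (spinBasis k) (spinBasis l) = 2 * X (sharp a) (sharp b) := by
  simp only [wedge₂_apply, mul_sub, Finset.sum_sub_distrib, sum_sharp]
  rw [hX (sharp a)]
  ring

lemma contraction_wedge₄ {X : LinearMap.BilinForm ℂ S} (hX : ∀ s t, X t s = -X s t)
    (a b c d : Module.Dual ℂ S) (s t : S) :
    contraction X s t (wedge₄ a b c d) = 2 * (
      wedge₂ a b s t * X (sharp c) (sharp d) - wedge₂ a c s t * X (sharp b) (sharp d)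
      + wedge₂ a d s t * X (sharp b) (sharp c) + wedge₂ b c s t * X (sharp a) (sharp d)
      - wedge₂ b d s t * X (sharp a) (sharp c) + wedge₂ c d s t * X (sharp a) (sharp b)) := by
  simp only [contraction, LinearMap.sum_apply, LinearMap.smul_apply, LinearMap.flip_apply,
    pairingDual_wedge₄, smul_eq_mul, mul_add, mul_sub, Finset.sum_add_distrib,
    Finset.sum_sub_distrib, mul_left_comm _ (wedge₂ _ _ s t), ← Finset.mul_sum,
    sum_sharp_wedge₂ hX]

attribute [irreducible] contraction

lemma sharp_comp {A : GLS} (hA : A ∈ O) (a : Module.Dual ℂ S) :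
    (A : Module.End ℂ S) (sharp (LinearMap.dualMap (A : Module.End ℂ S) a)) = sharp a := by
  have h : ∀ (b : Module.Dual ℂ S) t, η (sharp b) t = b t := fun b t =>
    LinearMap.BilinForm.apply_toDual_symm_apply ..
  refine (sharp_eq fun t => ?_).symm
  rw [← apply_inv_apply A t, hA, h, LinearMap.dualMap_apply]

/-- The contraction uses only η and the pairing, so it is natural for isometries. If A^*Q = cQ,
pulling back by A turns an eigenvector of the contraction with Q into one whose eigenvalue is
divided by c. -/
lemma contraction_map {A : GLS} (hA : A ∈ O) {X : LinearMap.BilinForm ℂ S}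
    (hX : ∀ s t, X t s = -X s t) (s t : S) (ω : FourForms) :
    contraction (X.comp (A : Module.End ℂ S) (A : Module.End ℂ S)) s t
      (exteriorPower.map 4 (LinearMap.dualMap (A : Module.End ℂ S)) ω) =
    contraction X ((A : Module.End ℂ S) s) ((A : Module.End ℂ S) t) ω := by
  have h : contraction (X.comp (A : Module.End ℂ S) (A : Module.End ℂ S)) s t ∘ₗ
      exteriorPower.map 4 (LinearMap.dualMap (A : Module.End ℂ S)) =
    contraction X ((A : Module.End ℂ S) s) ((A : Module.End ℂ S) t) := by
    refine exteriorPower.linearMap_ext (AlternatingMap.ext fun a => ?_)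
    have e : ∀ a : Fin 4 → Module.Dual ℂ S, exteriorPower.ιMulti ℂ 4 a =
        wedge₄ (a 0) (a 1) (a 2) (a 3) := fun a => by
      rw [wedge₄]
      congr 1
      funext i
      fin_cases i <;> rfl
    have hX' : ∀ s t, X.comp (A : Module.End ℂ S) (A : Module.End ℂ S) t s =
        -X.comp (A : Module.End ℂ S) (A : Module.End ℂ S) s t := fun s t => hX _ _
    rw [LinearMap.compAlternatingMap_apply, LinearMap.compAlternatingMap_apply,
      LinearMap.comp_apply, exteriorPower.map_apply_ιMulti, e, e a, contraction_wedge₄ hX',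
      contraction_wedge₄ hX]
    simp only [LinearMap.BilinForm.comp_apply, Function.comp_apply, sharp_comp hA]
    rfl
  exact LinearMap.congr_fun h ω

/-- The contraction of a bilinear form with a decomposable four-form, as a bilinear form. -/
def wedgeContraction (X : LinearMap.BilinForm ℂ S) (a b c d : Module.Dual ℂ S) :
    LinearMap.BilinForm ℂ S :=
  (2 : ℂ) • (X (sharp c) (sharp d) • wedge₂ a b - X (sharp b) (sharp d) • wedge₂ a c
    + X (sharp b) (sharp c) • wedge₂ a d + X (sharp a) (sharp d) • wedge₂ b c
    - X (sharp a) (sharp c) • wedge₂ b d + X (sharp a) (sharp b) • wedge₂ c d)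

/-- The contraction of a bilinear form with the Cayley form, as a bilinear form. -/
def cayleyOp (X : LinearMap.BilinForm ℂ S) : LinearMap.BilinForm ℂ S :=
  wedgeContraction X (φ 0) (φ 1) (ψ 0) (ψ 1) + wedgeContraction X (φ 0) (φ 2) (ψ 0) (ψ 2)
  + wedgeContraction X (φ 0) (φ 3) (ψ 0) (ψ 3) - wedgeContraction X (φ 1) (φ 2) (ψ 1) (ψ 2)
  - wedgeContraction X (φ 1) (φ 3) (ψ 1) (ψ 3) - wedgeContraction X (φ 2) (φ 3) (ψ 2) (ψ 3)
  - (2 : ℂ) • wedgeContraction X (φ 0) (ψ 1) (ψ 2) (ψ 3)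
  + (2 : ℂ) • wedgeContraction X (φ 1) (φ 2) (φ 3) (ψ 0)

lemma contraction_wedge₄' {X : LinearMap.BilinForm ℂ S} (hX : ∀ s t, X t s = -X s t)
    (a b c d : Module.Dual ℂ S) (s t : S) :
    contraction X s t (wedge₄ a b c d) = wedgeContraction X a b c d s t := by
  rw [contraction_wedge₄ hX]
  simp only [wedgeContraction, LinearMap.add_apply, LinearMap.sub_apply, LinearMap.smul_apply,
    smul_eq_mul]
  ring

lemma contraction_Q {X : LinearMap.BilinForm ℂ S} (hX : ∀ s t, X t s = -X s t) (s t : S) :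
    contraction X s t Q = cayleyOp X s t := by
  simp only [Q, map_add, map_sub, map_smul, contraction_wedge₄' hX, cayleyOp,
    LinearMap.add_apply, LinearMap.sub_apply, LinearMap.smul_apply]

lemma wedgeContraction_swap (X : LinearMap.BilinForm ℂ S) (a b c d : Module.Dual ℂ S) (s t : S) :
    wedgeContraction X a b c d t s = -wedgeContraction X a b c d s t := by
  simp only [wedgeContraction, wedge₂_apply, LinearMap.add_apply, LinearMap.sub_apply,
    LinearMap.smul_apply, smul_eq_mul]
  ring

lemma cayleyOp_swap (X : LinearMap.BilinForm ℂ S) (s t : S) :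
    cayleyOp X t s = -cayleyOp X s t := by
  simp only [cayleyOp, LinearMap.add_apply, LinearMap.sub_apply, LinearMap.smul_apply,
    smul_eq_mul, wedgeContraction_swap X _ _ _ _ s t]
  ring

/-! ### The eigenspaces of the contraction with the Cayley form -/

/-- The spinors `φ_i`. -/
def spinφ (i : Fin 4) : S := spinBasis (.inl i)

/-- The spinors `ψ_i`. -/
def spinψ (i : Fin 4) : S := spinBasis (.inr i)

lemma sharp_φ' (i : Fin 4) : sharp (φ i) = spinψ i := sharp_φ i
lemma sharp_ψ' (i : Fin 4) : sharp (ψ i) = spinφ i := sharp_ψ i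
lemma φ_spinφ (i j : Fin 4) : φ i (spinφ j) = if j = i then 1 else 0 := φ_inl i j
lemma φ_spinψ (i j : Fin 4) : φ i (spinψ j) = 0 := φ_inr i j
lemma ψ_spinψ (i j : Fin 4) : ψ i (spinψ j) = if j = i then 1 else 0 := ψ_inr i j
lemma ψ_spinφ (i j : Fin 4) : ψ i (spinφ j) = 0 := ψ_inl i j

section Entries

variable {X : LinearMap.BilinForm ℂ S} (hX : ∀ s t, X t s = -X s t)

include hX

lemma apply_self_eq_zero (s : S) : X s s = 0 := self_eq_neg.1 (hX s s)

/-- Of the 28 coordinates of a two-form, twelve are simply multiplied by 2. Twelve others form six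
2×2 blocks, which couple φ₀ψᵢ with φⱼφₖ and φᵢψ₀ with ψⱼψₖ for (i, j, k) cyclic. The four entries
φᵢψᵢ form one 4×4 block. -/
lemma cayleyOp_apply (s t : S) : cayleyOp X s t = 2 * (
      (X (spinφ 0) (spinφ 1)) * wedge₂ (φ 0) (φ 1) s t
      + (X (spinφ 0) (spinφ 2)) * wedge₂ (φ 0) (φ 2) s t
      + (X (spinφ 0) (spinφ 3)) * wedge₂ (φ 0) (φ 3) s t
      + (X (spinφ 1) (spinψ 1) + X (spinφ 2) (spinψ 2) + X (spinφ 3) (spinψ 3)) * wedge₂ (φ 0) (ψ 0) s t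
      + (-X (spinφ 0) (spinψ 1) - 2 * X (spinφ 2) (spinφ 3)) * wedge₂ (φ 0) (ψ 1) s t
      + (-X (spinφ 0) (spinψ 2) + 2 * X (spinφ 1) (spinφ 3)) * wedge₂ (φ 0) (ψ 2) s t
      + (-X (spinφ 0) (spinψ 3) - 2 * X (spinφ 1) (spinφ 2)) * wedge₂ (φ 0) (ψ 3) s t
      + (-X (spinφ 1) (spinφ 2) - 2 * X (spinφ 0) (spinψ 3)) * wedge₂ (φ 1) (φ 2) s t
      + (-X (spinφ 1) (spinφ 3) + 2 * X (spinφ 0) (spinψ 2)) * wedge₂ (φ 1) (φ 3) s t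
      + (-X (spinφ 1) (spinψ 0) + 2 * X (spinψ 2) (spinψ 3)) * wedge₂ (φ 1) (ψ 0) s t
      + (X (spinφ 0) (spinψ 0) - X (spinφ 2) (spinψ 2) - X (spinφ 3) (spinψ 3)) * wedge₂ (φ 1) (ψ 1) s t
      + (X (spinφ 1) (spinψ 2)) * wedge₂ (φ 1) (ψ 2) s t
      + (X (spinφ 1) (spinψ 3)) * wedge₂ (φ 1) (ψ 3) s t
      + (-X (spinφ 2) (spinφ 3) - 2 * X (spinφ 0) (spinψ 1)) * wedge₂ (φ 2) (φ 3) s t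
      + (-X (spinφ 2) (spinψ 0) - 2 * X (spinψ 1) (spinψ 3)) * wedge₂ (φ 2) (ψ 0) s t
      + (X (spinφ 2) (spinψ 1)) * wedge₂ (φ 2) (ψ 1) s t
      + (X (spinφ 0) (spinψ 0) - X (spinφ 1) (spinψ 1) - X (spinφ 3) (spinψ 3)) * wedge₂ (φ 2) (ψ 2) s t
      + (X (spinφ 2) (spinψ 3)) * wedge₂ (φ 2) (ψ 3) s t
      + (-X (spinφ 3) (spinψ 0) + 2 * X (spinψ 1) (spinψ 2)) * wedge₂ (φ 3) (ψ 0) s t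
      + (X (spinφ 3) (spinψ 1)) * wedge₂ (φ 3) (ψ 1) s t
      + (X (spinφ 3) (spinψ 2)) * wedge₂ (φ 3) (ψ 2) s t
      + (X (spinφ 0) (spinψ 0) - X (spinφ 1) (spinψ 1) - X (spinφ 2) (spinψ 2)) * wedge₂ (φ 3) (ψ 3) s t
      + (X (spinψ 0) (spinψ 1)) * wedge₂ (ψ 0) (ψ 1) s t
      + (X (spinψ 0) (spinψ 2)) * wedge₂ (ψ 0) (ψ 2) s t
      + (X (spinψ 0) (spinψ 3)) * wedge₂ (ψ 0) (ψ 3) s t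
      + (-X (spinψ 1) (spinψ 2) + 2 * X (spinφ 3) (spinψ 0)) * wedge₂ (ψ 1) (ψ 2) s t
      + (-X (spinψ 1) (spinψ 3) - 2 * X (spinφ 2) (spinψ 0)) * wedge₂ (ψ 1) (ψ 3) s t
      + (-X (spinψ 2) (spinψ 3) + 2 * X (spinφ 1) (spinψ 0)) * wedge₂ (ψ 2) (ψ 3) s t) := by
  simp only [cayleyOp, wedgeContraction, sharp_φ', sharp_ψ', hX (spinφ _) (spinψ _),
    LinearMap.add_apply, LinearMap.sub_apply, LinearMap.smul_apply, smul_eq_mul]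
  ring

lemma cayleyOp_φ_zero_φ (i : Fin 3) : cayleyOp X (spinφ 0) (spinφ i.succ) =
    2 * X (spinφ 0) (spinφ i.succ) := by
  fin_cases i <;>
  simp [cayleyOp_apply hX, wedge₂_apply, φ_spinφ, ψ_spinφ]

lemma cayleyOp_ψ_zero_ψ (i : Fin 3) : cayleyOp X (spinψ 0) (spinψ i.succ) =
    2 * X (spinψ 0) (spinψ i.succ) := by
  fin_cases i <;>
  simp [cayleyOp_apply hX, wedge₂_apply, φ_spinψ, ψ_spinψ]

lemma cayleyOp_φ_ψ_of_ne (i j : Fin 3) (hij : i ≠ j) : cayleyOp X (spinφ i.succ) (spinψ j.succ) =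
    2 * X (spinφ i.succ) (spinψ j.succ) := by
  fin_cases i <;> fin_cases j <;> (first | (exact absurd rfl hij) | skip) <;>
  simp [cayleyOp_apply hX, wedge₂_apply, φ_spinφ, φ_spinψ, ψ_spinφ, ψ_spinψ]

lemma cayleyOp_φ_zero_ψ (i : Fin 3) : cayleyOp X (spinφ 0) (spinψ i.succ) =
    2 * (-X (spinφ 0) (spinψ i.succ) - 2 * X (spinφ (i + 1).succ) (spinφ (i + 2).succ)) := by
  fin_cases i <;>
  simp [cayleyOp_apply hX, wedge₂_apply, φ_spinφ, φ_spinψ, ψ_spinφ, ψ_spinψ,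
    hX (spinφ 1) (spinφ 3)]

lemma cayleyOp_φ_φ (i : Fin 3) : cayleyOp X (spinφ (i + 1).succ) (spinφ (i + 2).succ) =
    2 * (-X (spinφ (i + 1).succ) (spinφ (i + 2).succ) - 2 * X (spinφ 0) (spinψ i.succ)) := by
  fin_cases i <;>
  simp [cayleyOp_apply hX, wedge₂_apply, φ_spinφ, ψ_spinφ,
    hX (spinφ 1) (spinφ 3)] <;>
  ring

lemma cayleyOp_φ_ψ_zero (i : Fin 3) : cayleyOp X (spinφ i.succ) (spinψ 0) =
    2 * (-X (spinφ i.succ) (spinψ 0) + 2 * X (spinψ (i + 1).succ) (spinψ (i + 2).succ)) := by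
  fin_cases i <;>
  simp [cayleyOp_apply hX, wedge₂_apply, φ_spinφ, φ_spinψ, ψ_spinφ, ψ_spinψ,
    hX (spinψ 1) (spinψ 3)] <;>
  ring

lemma cayleyOp_ψ_ψ (i : Fin 3) : cayleyOp X (spinψ (i + 1).succ) (spinψ (i + 2).succ) =
    2 * (-X (spinψ (i + 1).succ) (spinψ (i + 2).succ) + 2 * X (spinφ i.succ) (spinψ 0)) := by
  fin_cases i <;>
  simp [cayleyOp_apply hX, wedge₂_apply, φ_spinψ, ψ_spinψ,
    hX (spinψ 1) (spinψ 3)] <;>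
  ring

lemma cayleyOp_φ_zero_ψ_zero : cayleyOp X (spinφ 0) (spinψ 0) = 2 * (X (spinφ 1) (spinψ 1)
    + X (spinφ 2) (spinψ 2) + X (spinφ 3) (spinψ 3)) := by
  simp [cayleyOp_apply hX, wedge₂_apply, φ_spinφ, φ_spinψ, ψ_spinφ, ψ_spinψ]

lemma cayleyOp_φ_ψ_self (i : Fin 3) : cayleyOp X (spinφ i.succ) (spinψ i.succ) =
    2 * (X (spinφ 0) (spinψ 0) - X (spinφ (i + 1).succ) (spinψ (i + 1).succ) - X (spinφ (i + 2).succ) (spinψ (i + 2).succ)) := by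
  fin_cases i <;>
  simp [cayleyOp_apply hX, wedge₂_apply, φ_spinφ, φ_spinψ, ψ_spinφ, ψ_spinψ] <;>
  ring

/-- The hypotheses follow the block structure of the contraction. Addition in `Fin 3` is cyclic, so
the pairs (i + 1, i + 2) run once through the pairs of distinct non-zero indices, up to order. -/
lemma eq_zero_of_entries (h1 : ∀ i : Fin 3, X (spinφ 0) (spinφ i.succ) = 0)
    (h2 : ∀ i : Fin 3, X (spinψ 0) (spinψ i.succ) = 0)
    (h3 : ∀ i j : Fin 3, X (spinφ i.succ) (spinψ j.succ) = 0)
    (h4 : ∀ i : Fin 3, X (spinφ 0) (spinψ i.succ) = 0)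
    (h5 : ∀ i : Fin 3, X (spinφ (i + 1).succ) (spinφ (i + 2).succ) = 0)
    (h6 : ∀ i : Fin 3, X (spinφ i.succ) (spinψ 0) = 0)
    (h7 : ∀ i : Fin 3, X (spinψ (i + 1).succ) (spinψ (i + 2).succ) = 0)
    (h8 : X (spinφ 0) (spinψ 0) = 0) : X = 0 := by
  have hφψ : ∀ i j, X (spinφ i) (spinψ j) = 0 := by
    intro i j
    cases i using Fin.cases <;> cases j using Fin.cases
    exacts [h8, h4 _, h6 _, h3 _ _]
  have key : ∀ f : Fin 4 → S, (∀ i : Fin 3, X (f 0) (f i.succ) = 0) →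
      (∀ i : Fin 3, X (f (i + 1).succ) (f (i + 2).succ) = 0) → ∀ i j, X (f i) (f j) = 0 := by
    intro f hf hf' i j
    have hf1 := hf 0
    have hf2 := hf 1
    have hf3 := hf 2
    have hf4 := hf' 0
    have hf5 := hf' 1
    have hf6 := hf' 2
    simp at hf1 hf2 hf3 hf4 hf5 hf6
    fin_cases i <;> fin_cases j <;>
      first
      | exact apply_self_eq_zero hX _
      | (simp; assumption)
      | (rw [hX, neg_eq_zero]; simp; assumption)
  refine spinBasis.ext fun k => spinBasis.ext fun l => ?_
  rcases k with k | k <;> rcases l with l | l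
  · exact key spinφ h1 h5 k l
  · exact hφψ k l
  · exact (hX _ _).trans (neg_eq_zero.2 (hφψ l k))
  · exact key spinψ h2 h7 k l

/-- The eigenvalues of the contraction with the Cayley form on two-forms. -/
lemma eigenvalue_cayleyOp (hX0 : X ≠ 0) {μ : ℂ} (h : cayleyOp X = (2 * μ) • X) :
    μ = -3 ∨ μ = 1 := by
  by_contra! hμ
  have hK : (μ + 3) * (μ - 1) ≠ 0 :=
    mul_ne_zero (fun h => hμ.1 (by linear_combination h)) (fun h => hμ.2 (by linear_combination h))
  have h1 : μ - 1 ≠ 0 := right_ne_zero_of_mul hK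
  have hs : ∀ s t, cayleyOp X s t = 2 * μ * X s t := fun s t => by
    rw [h, LinearMap.smul_apply, LinearMap.smul_apply, smul_eq_mul]
  have hlin : ∀ x : ℂ, 2 * x = 2 * μ * x → x = 0 := by
    intro x hx
    refine (mul_eq_zero.1 (?_ : (μ - 1) * x = 0)).resolve_left h1
    linear_combination -(1 / 2) * hx
  -- In a 2×2 block (μ + 1)x = cy and (μ + 1)y = cx, hence ((μ + 1)² - 4)x = 0, and (μ + 1)² - 4 =
  -- (μ + 3)(μ - 1).
  have hblock : ∀ x y c : ℂ, c * c = 4 → 2 * (-x + c * y) = 2 * μ * x →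
      2 * (-y + c * x) = 2 * μ * y → x = 0 := by
    intro x y c hc hx hy
    refine (mul_eq_zero.1 (?_ : (μ + 3) * (μ - 1) * x = 0)).resolve_left hK
    linear_combination (-(μ + 1) / 2) * hx - (c / 2) * hy + x * hc
  have e0 := (cayleyOp_φ_zero_ψ_zero hX).symm.trans (hs _ _)
  have e1 : 2 * (X (spinφ 0) (spinψ 0) - X (spinφ 2) (spinψ 2) - X (spinφ 3) (spinψ 3)) =
    2 * μ * X (spinφ 1) (spinψ 1) := (cayleyOp_φ_ψ_self hX 0).symm.trans (hs _ _)
  have e2 : 2 * (X (spinφ 0) (spinψ 0) - X (spinφ 3) (spinψ 3) - X (spinφ 1) (spinψ 1)) =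
    2 * μ * X (spinφ 2) (spinψ 2) := (cayleyOp_φ_ψ_self hX 1).symm.trans (hs _ _)
  have e3 : 2 * (X (spinφ 0) (spinψ 0) - X (spinφ 1) (spinψ 1) - X (spinφ 2) (spinψ 2)) =
    2 * μ * X (spinφ 3) (spinψ 3) := (cayleyOp_φ_ψ_self hX 2).symm.trans (hs _ _)
  -- In the 4×4 block, summing the last three equations and eliminating the sum of the last three
  -- entries leaves the same polynomial (μ + 3)(μ - 1) times the first entry.
  have h00 : X (spinφ 0) (spinψ 0) = 0 := by
    refine (mul_eq_zero.1 (?_ : (μ + 3) * (μ - 1) * _ = 0)).resolve_left hK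
    linear_combination (-(μ + 2) / 2) * e0 - (1 / 2) * (e1 + e2 + e3)
  rw [h00] at e0 e1 e2 e3
  have b1 := fun i => (cayleyOp_φ_zero_ψ hX i).symm.trans (hs _ _)
  have b2 := fun i => (cayleyOp_φ_φ hX i).symm.trans (hs _ _)
  have c1 := fun i => (cayleyOp_φ_ψ_zero hX i).symm.trans (hs _ _)
  have c2 := fun i => (cayleyOp_ψ_ψ hX i).symm.trans (hs _ _)
  apply hX0
  apply eq_zero_of_entries hX
  · exact fun i => hlin _ ((cayleyOp_φ_zero_φ hX i).symm.trans (hs _ _))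
  · exact fun i => hlin _ ((cayleyOp_ψ_zero_ψ hX i).symm.trans (hs _ _))
  rotate_left
  · refine fun i => hblock _ (X (spinφ (i + 1).succ) (spinφ (i + 2).succ)) (-2) (by norm_num) ?_ ?_
    · linear_combination b1 i
    · linear_combination b2 i
  · refine fun i => hblock _ (X (spinφ 0) (spinψ i.succ)) (-2) (by norm_num) ?_ ?_
    · linear_combination b2 i
    · linear_combination b1 i
  · exact fun i => hblock _ _ 2 (by norm_num) (c1 i) (c2 i)
  · exact fun i => hblock _ _ 2 (by norm_num) (c2 i) (c1 i)
  · exact h00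
  intro i j
  by_cases hij : i = j
  · subst hij
    fin_cases i
    · exact hlin (X (spinφ 1) (spinψ 1)) (by linear_combination e0 + e1)
    · exact hlin (X (spinφ 2) (spinψ 2)) (by linear_combination e0 + e2)
    · exact hlin (X (spinφ 3) (spinψ 3)) (by linear_combination e0 + e3)
  · exact hlin _ ((cayleyOp_φ_ψ_of_ne hX i j hij).symm.trans (hs _ _))

end Entries

lemma twoForm_spinφ_spinφ (v : V) (i j : Fin 4) : twoForm v (spinφ i) (spinφ j) = (Real.sqrt 2 : ℂ) *
    ![![0, 0, 0, 0], ![0, 0, v 4, -v 5], ![0, -v 4, 0, v 6], ![0, v 5, -v 6, 0]] i j := by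
  rw [twoForm_eq]
  fin_cases i <;> fin_cases j <;> simp [wedge₂_apply, φ_spinφ, ψ_spinφ]

lemma twoForm_spinψ_spinψ (v : V) (i j : Fin 4) : twoForm v (spinψ i) (spinψ j) = (Real.sqrt 2 : ℂ) *
    ![![0, 0, 0, 0], ![0, 0, v 2, -v 1], ![0, -v 2, 0, v 0], ![0, v 1, -v 0, 0]] i j := by
  rw [twoForm_eq]
  fin_cases i <;> fin_cases j <;> simp [wedge₂_apply, φ_spinψ, ψ_spinψ]

lemma twoForm_spinφ_spinψ (v : V) (i j : Fin 4) : twoForm v (spinφ i) (spinψ j) =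
    ![![v 3 * Complex.I, Real.sqrt 2 * v 6, Real.sqrt 2 * v 5, Real.sqrt 2 * v 4],
      ![-(Real.sqrt 2 * v 0), -(v 3 * Complex.I), 0, 0],
      ![-(Real.sqrt 2 * v 1), 0, -(v 3 * Complex.I), 0],
      ![-(Real.sqrt 2 * v 2), 0, 0, -(v 3 * Complex.I)]] i j := by
  rw [twoForm_eq]
  fin_cases i <;> fin_cases j <;> simp [wedge₂_apply, φ_spinφ, φ_spinψ, ψ_spinφ, ψ_spinψ]

/-- The images of vectors fill the eigenvalue -6 part of every block: one dimension in each of the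
six 2×2 blocks and one, spanned by (1, -1, -1, -1), in the 4×4 block. -/
lemma cayleyOp_twoForm (v : V) : cayleyOp (twoForm v) = (-6 : ℂ) • twoForm v := by
  have hT := twoForm_swap v
  have hY : ∀ s t, (cayleyOp (twoForm v) + (6 : ℂ) • twoForm v) t s =
      -(cayleyOp (twoForm v) + (6 : ℂ) • twoForm v) s t := fun s t => by
    simp only [LinearMap.add_apply, LinearMap.smul_apply, smul_eq_mul, cayleyOp_swap _ s t, hT s t]
    ring
  have key := eq_zero_of_entries hY ?_ ?_ ?_ ?_ ?_ ?_ ?_ ?_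
  · refine (eq_neg_of_add_eq_zero_left key).trans ?_
    module
  all_goals
    simp only [LinearMap.add_apply, LinearMap.smul_apply, smul_eq_mul]
  · intro i
    rw [cayleyOp_φ_zero_φ hT, twoForm_spinφ_spinφ]
    fin_cases i <;> simp
  · intro i
    rw [cayleyOp_ψ_zero_ψ hT, twoForm_spinψ_spinψ]
    fin_cases i <;> simp
  · intro i j
    by_cases hij : i = j
    · subst hij
      rw [cayleyOp_φ_ψ_self hT]
      simp only [twoForm_spinφ_spinψ]
      fin_cases i <;> simp <;> ring
    · rw [cayleyOp_φ_ψ_of_ne hT i j hij, twoForm_spinφ_spinψ]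
      fin_cases i <;> fin_cases j <;> first | (exact absurd rfl hij) | simp
  · intro i
    rw [cayleyOp_φ_zero_ψ hT, twoForm_spinφ_spinφ, twoForm_spinφ_spinψ]
    fin_cases i <;> simp <;> ring
  · intro i
    rw [cayleyOp_φ_φ hT, twoForm_spinφ_spinφ, twoForm_spinφ_spinψ]
    fin_cases i <;> simp <;> ring
  · intro i
    rw [cayleyOp_φ_ψ_zero hT, twoForm_spinψ_spinψ, twoForm_spinφ_spinψ]
    fin_cases i <;> simp <;> ring
  · intro i
    rw [cayleyOp_ψ_ψ hT, twoForm_spinψ_spinψ, twoForm_spinφ_spinψ]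
    fin_cases i <;> simp <;> ring
  · rw [cayleyOp_φ_zero_ψ_zero hT]
    simp only [twoForm_spinφ_spinψ]
    simp
    ring

/-- The eigenspace of the contraction with the Cayley form for the eigenvalue `-6` is contained
in the image of `V`. -/
lemma exists_eq_twoForm {X : LinearMap.BilinForm ℂ S} (hX : ∀ s t, X t s = -X s t)
    (h : cayleyOp X = (-6 : ℂ) • X) : ∃ v, X = twoForm v := by
  have hs : ∀ s t, cayleyOp X s t = -6 * X s t := fun s t => by
    rw [h, LinearMap.smul_apply, LinearMap.smul_apply, smul_eq_mul]
  have hr : (Real.sqrt 2 : ℂ) ≠ 0 := by simp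
  have a1 := fun i => (cayleyOp_φ_zero_φ hX i).symm.trans (hs _ _)
  have a2 := fun i => (cayleyOp_ψ_zero_ψ hX i).symm.trans (hs _ _)
  have a3 := fun i j hij => (cayleyOp_φ_ψ_of_ne hX i j hij).symm.trans (hs _ _)
  have b2 := fun i => (cayleyOp_φ_φ hX i).symm.trans (hs _ _)
  have c2 := fun i => (cayleyOp_ψ_ψ hX i).symm.trans (hs _ _)
  have e0 := (cayleyOp_φ_zero_ψ_zero hX).symm.trans (hs _ _)
  have e1 : 2 * (X (spinφ 0) (spinψ 0) - X (spinφ 2) (spinψ 2) - X (spinφ 3) (spinψ 3)) =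
    -6 * X (spinφ 1) (spinψ 1) := (cayleyOp_φ_ψ_self hX 0).symm.trans (hs _ _)
  have e2 : 2 * (X (spinφ 0) (spinψ 0) - X (spinφ 3) (spinψ 3) - X (spinφ 1) (spinψ 1)) =
    -6 * X (spinφ 2) (spinψ 2) := (cayleyOp_φ_ψ_self hX 1).symm.trans (hs _ _)
  have e3 : 2 * (X (spinφ 0) (spinψ 0) - X (spinφ 1) (spinψ 1) - X (spinφ 2) (spinψ 2)) =
    -6 * X (spinφ 3) (spinψ 3) := (cayleyOp_φ_ψ_self hX 2).symm.trans (hs _ _)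
  -- The coordinates are solved from the entries of `twoForm_spinφ_spinψ` in the row of φ₀ and the
  -- column of ψ₀; the factor -I in the R-coordinate is 1/I. The eigenvalue equation determines all
  -- other entries from these.
  let v : V := ![-X (spinφ 1) (spinψ 0) / Real.sqrt 2, -X (spinφ 2) (spinψ 0) / Real.sqrt 2,
    -X (spinφ 3) (spinψ 0) / Real.sqrt 2, -X (spinφ 0) (spinψ 0) * Complex.I,
    X (spinφ 0) (spinψ 3) / Real.sqrt 2, X (spinφ 0) (spinψ 2) / Real.sqrt 2,
    X (spinφ 0) (spinψ 1) / Real.sqrt 2]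
  have v0 : Real.sqrt 2 * v 0 = -X (spinφ 1) (spinψ 0) := mul_div_cancel₀ _ hr
  have v1 : Real.sqrt 2 * v 1 = -X (spinφ 2) (spinψ 0) := mul_div_cancel₀ _ hr
  have v2 : Real.sqrt 2 * v 2 = -X (spinφ 3) (spinψ 0) := mul_div_cancel₀ _ hr
  have v3 : v 3 * Complex.I = X (spinφ 0) (spinψ 0) := by
    change -X (spinφ 0) (spinψ 0) * Complex.I * Complex.I = _
    linear_combination -X (spinφ 0) (spinψ 0) * Complex.I_mul_I
  have v4 : Real.sqrt 2 * v 4 = X (spinφ 0) (spinψ 3) := mul_div_cancel₀ _ hr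
  have v5 : Real.sqrt 2 * v 5 = X (spinφ 0) (spinψ 2) := mul_div_cancel₀ _ hr
  have v6 : Real.sqrt 2 * v 6 = X (spinφ 0) (spinψ 1) := mul_div_cancel₀ _ hr
  refine ⟨v, sub_eq_zero.1 ?_⟩
  have hY : ∀ s t, (X - twoForm v) t s = -(X - twoForm v) s t := fun s t => by
    simp only [LinearMap.sub_apply, hX s t, twoForm_swap v s t]
    ring
  generalize v = w at *
  apply eq_zero_of_entries hY
  all_goals
    simp only [LinearMap.sub_apply]
  · intro i
    rw [twoForm_spinφ_spinφ, show X (spinφ 0) (spinφ i.succ) = 0 by linear_combination a1 i / 8]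
    fin_cases i <;> simp
  · intro i
    rw [twoForm_spinψ_spinψ, show X (spinψ 0) (spinψ i.succ) = 0 by linear_combination a2 i / 8]
    fin_cases i <;> simp
  · intro i j
    rw [twoForm_spinφ_spinψ]
    by_cases hij : i = j
    · subst hij
      fin_cases i <;> simp [v3]
      · linear_combination (e0 + e1) / 8
      · linear_combination (e0 + e2) / 8
      · linear_combination (e0 + e3) / 8
    · rw [show X (spinφ i.succ) (spinψ j.succ) = 0 by linear_combination a3 i j hij / 8]
      fin_cases i <;> fin_cases j <;> first | (exact absurd rfl hij) | simp
  · intro i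
    rw [twoForm_spinφ_spinψ]
    fin_cases i <;> simp [v4, v5, v6]
  · intro i
    rw [twoForm_spinφ_spinφ, show X (spinφ (i + 1).succ) (spinφ (i + 2).succ) =
      X (spinφ 0) (spinψ i.succ) by linear_combination b2 i / 4]
    fin_cases i <;> simp [v4, v5, v6]
  · intro i
    rw [twoForm_spinφ_spinψ]
    fin_cases i <;> simp [v0, v1, v2]
  · intro i
    rw [twoForm_spinψ_spinψ, show X (spinψ (i + 1).succ) (spinψ (i + 2).succ) =
      -X (spinφ i.succ) (spinψ 0) by linear_combination c2 i / 4]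
    fin_cases i <;> simp [v0, v1, v2]
  · rw [twoForm_spinφ_spinψ]
    simp [v3]

end CayleySpin

/-! ### From the pin group to the spin group: fixed points of the grading involution. -/

namespace CliffordAlgebra

lemma mem_even_of_involute_eq {R M : Type*} [CommRing R] [AddCommGroup M] [Module R M]
    {Q : QuadraticForm R M} [Invertible (2 : R)] {x : CliffordAlgebra Q} (hx : involute x = x) :
    x ∈ even Q := by
  have h : x ∈ evenOdd Q 0 ⊔ evenOdd Q 1 := by
    rw [(evenOdd_isCompl (Q := Q)).sup_eq_top]; trivial
  obtain ⟨y, hy, z, hz, rfl⟩ := Submodule.mem_sup.1 h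
  rw [map_add, involute_eq_of_mem_even hy, involute_eq_of_mem_odd hz] at hx
  have hz2 : (2 : R) • z = 0 := by
    have : -z = z := add_left_cancel hx
    rw [two_smul]
    nth_rewrite 1 [← this]
    exact neg_add_cancel z
  have hz0 : z = 0 := by
    rw [← one_smul R z, ← invOf_mul_self (2 : R), mul_smul, hz2, smul_zero]
  rw [hz0, add_zero]
  exact hy

end CliffordAlgebra

/-! ### Isometries of η that preserve the class of Q. -/

namespace CayleySpin

lemma twoForm_injective : Function.Injective twoForm := fun v w h =>
  cliffordAction_injective (LinearMap.ext fun s => eq_of_η_eq fun t => by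
    rw [← twoForm_apply, h, twoForm_apply])

lemma apply_eq_inv_smul {W : Type*} [AddCommGroup W] [Module ℂ W] {f g : Module.End ℂ W} {w : W}
    {c : ℂˣ} (hgf : g * f = 1) (hf : f w = (c : ℂ) • w) : g w = ((c⁻¹ : ℂˣ) : ℂ) • w := by
  have h : g (f w) = w := LinearMap.congr_fun hgf w
  rw [hf, map_smul] at h
  nth_rewrite 2 [← h]
  rw [smul_smul, ← Units.val_mul, inv_mul_cancel, Units.val_one, one_smul]

lemma map_inv_Q {A : GLS} {c : ℂˣ}
    (hQ : exteriorPower.map 4 (LinearMap.dualMap (A : Module.End ℂ S)) Q = (c : ℂ) • Q) :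
    exteriorPower.map 4 (LinearMap.dualMap ((A⁻¹ : GLS) : Module.End ℂ S)) Q =
      ((c⁻¹ : ℂˣ) : ℂ) • Q := by
  have h : ∀ A : GLS, actFour A⁻¹ Q =
      exteriorPower.map 4 (LinearMap.dualMap (A : Module.End ℂ S)) Q := fun A => by
    conv_rhs => rw [← inv_inv A]
    rfl
  exact (h A⁻¹).symm.trans (apply_eq_inv_smul
    ((map_mul actFour _ _).symm.trans ((congrArg actFour (inv_mul_cancel A⁻¹)).trans
      (map_one actFour))) ((h A).trans hQ))

lemma twoForm_comp_swap (v : V) (T : Module.End ℂ S) (s t : S) :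
    (twoForm v).comp T T t s = -(twoForm v).comp T T s t := twoForm_swap v (T s) (T t)

section Isometry

variable {A : GLS} (hA : A ∈ O) {c : ℂˣ}
  (hQ : exteriorPower.map 4 (LinearMap.dualMap (A : Module.End ℂ S)) Q = (c : ℂ) • Q)

include hA hQ

lemma cayleyOp_twoForm_comp (v : V) :
    cayleyOp ((twoForm v).comp (A : Module.End ℂ S) (A : Module.End ℂ S)) =
      (2 * (-3 * ((c⁻¹ : ℂˣ) : ℂ))) •
        (twoForm v).comp (A : Module.End ℂ S) (A : Module.End ℂ S) := by
  refine LinearMap.ext fun s => LinearMap.ext fun t => ?_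
  have h := contraction_map hA (twoForm_swap v) s t Q
  rw [hQ, map_smul, contraction_Q (twoForm_comp_swap v _), contraction_Q (twoForm_swap v),
    cayleyOp_twoForm] at h
  rw [LinearMap.smul_apply, LinearMap.smul_apply, smul_eq_mul, LinearMap.BilinForm.comp_apply]
  rw [LinearMap.smul_apply, LinearMap.smul_apply, smul_eq_mul, smul_eq_mul] at h
  have hc : ((c⁻¹ : ℂˣ) : ℂ) * c = 1 := by simp
  linear_combination ((c⁻¹ : ℂˣ) : ℂ) * h -
    cayleyOp ((twoForm v).comp (A : Module.End ℂ S) (A : Module.End ℂ S)) s t * hc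

/-- The pullback of a non-zero vector's two-form is a non-zero eigenvector with eigenvalue -6/c,
which has to be -6 or 2. -/
lemma scale_eq_or : (c : ℂ) = 1 ∨ (c : ℂ) = -3 := by
  have h0 : (twoForm (Pi.single 0 1)).comp (A : Module.End ℂ S) (A : Module.End ℂ S) ≠ 0 := by
    intro h
    have h1 : twoForm (Pi.single 0 1) = 0 := LinearMap.ext fun s => LinearMap.ext fun t => by
      have := LinearMap.congr_fun (LinearMap.congr_fun h (((A⁻¹ : GLS) : Module.End ℂ S) s))
        (((A⁻¹ : GLS) : Module.End ℂ S) t)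
      rwa [LinearMap.BilinForm.comp_apply, apply_inv_apply, apply_inv_apply] at this
    rw [← map_zero twoForm] at h1
    simpa using twoForm_injective h1
  have hc : ((c⁻¹ : ℂˣ) : ℂ) * c = 1 := by simp
  rcases eigenvalue_cayleyOp (twoForm_comp_swap _ _) h0 (cayleyOp_twoForm_comp hA hQ _)
    with h | h
  · left
    linear_combination (c / 3 : ℂ) * h + hc
  · right
    linear_combination -(c : ℂ) * h - 3 * hc

/-- The alternative also applies to A⁻¹ and c⁻¹, and -1/3 is neither 1 nor -3. -/
lemma scale_eq_one : c = 1 := by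
  have h1 := scale_eq_or hA hQ
  have h2 := scale_eq_or (inv_mem hA) (map_inv_Q hQ)
  have hc : ((c⁻¹ : ℂˣ) : ℂ) * c = 1 := by simp
  apply Units.ext
  rcases h1 with h | h
  · exact h
  · exfalso
    rcases h2 with h' | h' <;> rw [h, h'] at hc <;> norm_num at hc

/-- With c = 1 the pullback of the two-form of v stays in the -6 eigenspace, hence is the two-form
of some w. Since A is an isometry and η is non-degenerate, this becomes an identity of operators. -/
lemma exists_cliffordAction_mul_eq (v : V) : ∃ w, cliffordAction v * (A : Module.End ℂ S) =
    (A : Module.End ℂ S) * cliffordAction w := by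
  have h := cayleyOp_twoForm_comp hA hQ v
  rw [scale_eq_one hA hQ, inv_one, Units.val_one] at h
  rw [show (2 * (-3 * 1) : ℂ) = -6 by norm_num] at h
  obtain ⟨w, hw⟩ := exists_eq_twoForm (twoForm_comp_swap v _) h
  refine ⟨w, LinearMap.ext fun s => eq_of_η_eq fun t => ?_⟩
  have h1 := LinearMap.congr_fun (LinearMap.congr_fun hw s) (((A⁻¹ : GLS) : Module.End ℂ S) t)
  rw [LinearMap.BilinForm.comp_apply, apply_inv_apply, twoForm_apply, twoForm_apply,
    ← hA (cliffordAction w s) (((A⁻¹ : GLS) : Module.End ℂ S) t), apply_inv_apply] at h1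
  exact h1

/-- h is conjugation by A⁻¹. Linearity holds because `V` acts injectively, and h preserves `q`
because q(v) is the square of v. -/
lemma exists_isometry : ∃ h : V →ₗ[ℂ] V, (∀ v, q (h v) = q v) ∧
    ∀ v, cliffordAction v * (A : Module.End ℂ S) = (A : Module.End ℂ S) * cliffordAction (h v) := by
  choose h hh using exists_cliffordAction_mul_eq hA hQ
  have hinj : ∀ v w, (A : Module.End ℂ S) * cliffordAction v = A * cliffordAction w → v = w :=
    fun v w hvw => cliffordAction_injective (A.mul_right_inj.1 hvw)
  refine ⟨{ toFun := h, map_add' := fun v w => hinj _ _ ?_, map_smul' := fun r v => hinj _ _ ?_ },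
    fun v => ?_, hh⟩
  · rw [← hh, map_add, map_add, add_mul, mul_add, hh, hh]
  · rw [← hh, map_smul, RingHom.id_apply, map_smul, mul_smul_comm, ← hh, smul_mul_assoc]
  · have h1 : (A : Module.End ℂ S) * algebraMap ℂ _ (q (h v)) = A * algebraMap ℂ _ (q v) := by
      rw [← cliffordAction_sq, ← mul_assoc, ← hh, mul_assoc, ← hh, ← mul_assoc, cliffordAction_sq,
        Algebra.commutes]
    have h2 := LinearMap.congr_fun (A.mul_right_inj.1 h1) (spinBasis (.inl 0))
    simpa [φ_inl] using congrArg (φ 0) h2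

lemma mem_CSpin7 : A ∈ CSpin7 := by
  obtain ⟨h, hq, hh⟩ := exists_isometry hA hQ
  obtain ⟨n, b, hb, hb'⟩ := exists_orthogonal_basis_q
  obtain ⟨x, hx, s, hs, hi, hc⟩ := CliffordAlgebra.isPinLift_of_isometry b hb hb' h hq
  have hxu : IsUnit (cliffordRep x) := by
    obtain ⟨⟨y, -, rfl⟩, -⟩ := hx
    exact y.isUnit.map cliffordRep
  -- Conjugation by x, up to the sign s, is h, and conjugation by A undoes h. So A·x commutes with
  -- `V` up to s; for s = -1 it would vanish, although it is invertible.
  have hC : ∀ v, (A : Module.End ℂ S) * cliffordRep x * cliffordAction v =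
      s • (cliffordAction v * (A * cliffordRep x)) := by
    intro v
    have h1 := congrArg cliffordRep (hc v)
    rw [map_mul, map_smul, map_mul, cliffordRep_ι, cliffordRep_ι] at h1
    rw [mul_assoc, h1, mul_smul_comm, ← mul_assoc, ← hh, mul_assoc]
  have hne : (A : Module.End ℂ S) * cliffordRep x ≠ 0 := (A.isUnit.mul hxu).ne_zero
  rcases hs with rfl | rfl
  · obtain ⟨r, hr⟩ := exists_eq_smul_one_of_commute fun v => by simpa using hC v
    have hr0 : r ≠ 0 := by
      rintro rfl
      exact hne (by rw [hr, zero_smul])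
    have hxs : x ∈ spinGroup q :=
      ⟨hx, CliffordAlgebra.mem_even_of_involute_eq (by simpa using hi)⟩
    have hA' : A * spinRep ⟨x, hxs⟩ = homothety (Units.mk0 r hr0) := by
      apply Units.ext
      rw [Units.val_mul, spinRep_coe, hr]
      rfl
    refine (mem_scalarMul_iff _ _).2 ⟨(Units.mk0 r hr0)⁻¹, ⟨(⟨x, hxs⟩ : spinGroup q)⁻¹, ?_⟩⟩
    rw [eq_mul_inv_of_mul_eq hA', map_inv, map_inv, inv_mul_cancel_left]
  · exact absurd (eq_zero_of_anticommute hC) hne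

end Isometry

/-- Homotheties lie in both groups, so A may be rescaled into O(S), where `mem_CSpin7` applies. -/
theorem stabCayley_eq : stabCayley = CSpin7 := by
  refine le_antisymm (fun A hA => ?_) CSpin7_le_stabCayley
  obtain ⟨r, hr⟩ := (mem_scalarMul_iff _ _).1 (CO_eq ▸ hA.1)
  have hB : homothety r * A ∈ stabCayley := mul_mem (homothety_mem_stabCayley r) hA
  obtain ⟨c, hc⟩ := (mem_stabilizer_Q_iff _).1 hB.2
  have h := mem_CSpin7 hr hc
  refine (Subgroup.mul_mem_cancel_left _ ?_).1 h
  exact (mem_scalarMul_iff _ _).2 ⟨r⁻¹, by rw [← map_mul, inv_mul_cancel, map_one]; exact one_mem _⟩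

end CayleySpin

end

theorem lemma6p1 :
    -- the Cayley form is anti-self-dual
    CayleySpin.IsAntiSelfDual CayleySpin.Q ∧
    -- CO(S) = ℂˣ · O(S)
    CayleySpin.CO = CayleySpin.scalarMul CayleySpin.O ∧
    -- Spin(7) acts faithfully, so it is isomorphic to its image in GL(S)
    Function.Injective CayleySpin.spinRep ∧
    -- the stabilizer of [Q] in CO(S) is CSpin(7) = ℂˣ · Spin(7)
    CayleySpin.stabCayley = CayleySpin.CSpin7 :=
  ⟨CayleySpin.isAntiSelfDual_Q, CayleySpin.CO_eq, CayleySpin.spinRep_injective,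
    CayleySpin.stabCayley_eq⟩
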